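/- Let $\mathbb F_q$ be a finite field and let $n,l,m$ be integers with $1<m<n-1$ and $l>0$. Let $E$ be the subspace of $\mathbb F_q^{\,n+l}$ spanned by the last $l$ standard basis vectors, and let $X_m$ be the set of all subspaces of type $(m,0)$, that is, of all $m$-dimensional subspaces $P$ of $\mathbb F_q^{\,n+l}$ with $P\cap E=0$. For such $P$ write $P'\subseteq\mathbb F_q^{\,n}$ for the image of $P$ under the projection onto the first $n$ coordinates. Let $\Gamma^{(m)}=(X_m,R_{1,0})$ be the graph with vertex set $X_m$ in which $P$ and $Q$ are adjacent if and only if $\dim(P'\cap Q')=m-1$ and $\dim(P\cap Q)=m-1$. Let $P\Gamma L(n+l,\mathbb F_q)$ be the group of all invertible semilinear transformations of $\mathbb F_q^{\,n+l}$ modulo the nonzero scalars, acting on the set of subspaces of $\mathbb F_q^{\,n+l}$, and let $P\Gamma L(n+l,\mathbb F_q)_E$ be the stabilizer of $E$ in it. Then $$\operatorname{Aut}(\Gamma^{(m)})=P\Gamma L(n+l,\mathbb F_q)_E ,$$ in the sense that $g\mapsto (P\mapsto g(P))$ is a group isomorphism from $P\Gamma L(n+l,\mathbb F_q)_E$ onto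 the automorphism group of the graph $\Gamma^{(m)}$. -/

import Mathlib

/-! ### The projective semilinear group -/

section Semilinear

variable (F V : Type*) [Field F] [AddCommGroup V] [Module F V]

/-- The general semilinear group `ΓL(V)`: all bijections `g` of `V` that are additive and satisfy
`g (a • v) = σ a • g v` for some field automorphism `σ`. -/
def GammaL : Subgroup (Equiv.Perm V) where
  carrier := {g | (∀ v w : V, g (v + w) = g v + g w) ∧
    ∃ σ : F ≃+* F, ∀ (a : F) (v : V), g (a • v) = σ a • g v}
  one_mem' := ⟨fun _ _ => rfl, RingEquiv.refl F, fun _ _ => rfl⟩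
  mul_mem' := by
    rintro g h ⟨hg, σ, hσ⟩ ⟨hh, τ, hτ⟩
    refine ⟨fun v w => ?_, τ.trans σ, fun a v => ?_⟩
    · simp only [Equiv.Perm.mul_apply, hh, hg]
    · simp only [Equiv.Perm.mul_apply, hτ, hσ, RingEquiv.trans_apply]
  inv_mem' := by
    rintro g ⟨hg, σ, hσ⟩
    refine ⟨fun v w => ?_, σ.symm, fun a v => ?_⟩
    · apply g.injective
      simp only [hg, Equiv.Perm.coe_inv, Equiv.apply_symm_apply]
    · apply g.injective
      simp only [hσ, Equiv.Perm.coe_inv, Equiv.apply_symm_apply, RingEquiv.apply_symm_apply]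

/-- The subgroup of `ΓL(V)` formed by the maps `v ↦ c • v`, `c ∈ Fˣ`. -/
def scalarSubgroup : Subgroup (GammaL F V) where
  carrier := {g | ∃ c : Fˣ, ∀ v : V, (g : Equiv.Perm V) v = (c : F) • v}
  one_mem' := ⟨1, fun v => by simp⟩
  mul_mem' := by
    rintro g h ⟨c, hc⟩ ⟨d, hd⟩
    refine ⟨c * d, fun v => ?_⟩
    simp only [Subgroup.coe_mul, Equiv.Perm.mul_apply, hc, hd, Units.val_mul, mul_smul]
  inv_mem' := by
    rintro g ⟨c, hc⟩
    refine ⟨c⁻¹, fun v => ?_⟩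
    apply (g : Equiv.Perm V).injective
    rw [Subgroup.coe_inv, Equiv.Perm.coe_inv, Equiv.apply_symm_apply, hc, smul_smul, Units.mul_inv, one_smul]

instance scalarSubgroup_normal : (scalarSubgroup F V).Normal where
  conj_mem := by
    rintro h ⟨c, hc⟩ ⟨g, hg, σ, hσ⟩
    refine ⟨Units.map (σ : F →* F) c, fun v => ?_⟩
    simp only [Subgroup.coe_mul, Subgroup.coe_inv, Equiv.Perm.mul_apply, hc, hσ,
      Equiv.Perm.coe_inv, Equiv.apply_symm_apply]
    rfl

/-- The projective semilinear group `PΓL(V) = ΓL(V) / Fˣ`. -/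
def PGammaL : Type _ := GammaL F V ⧸ scalarSubgroup F V

instance : Group (PGammaL F V) :=
  inferInstanceAs (Group (GammaL F V ⧸ scalarSubgroup F V))

variable {F V}

/-- The class in `PΓL(V)` of a semilinear bijection. -/
def PGammaL.mk : GammaL F V →* PGammaL F V := QuotientGroup.mk' (scalarSubgroup F V)

/-- The image `g(W)` of a subspace `W` under a semilinear bijection `g`. -/
def GammaL.mapSubspace (g : GammaL F V) (W : Submodule F V) : Submodule F V where
  carrier := (g : Equiv.Perm V) '' W
  zero_mem' := by
    refine ⟨0, W.zero_mem, ?_⟩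
    have h := g.2.1 0 0
    rwa [add_zero, left_eq_add] at h
  add_mem' := by
    rintro _ _ ⟨x, hx, rfl⟩ ⟨y, hy, rfl⟩
    exact ⟨x + y, W.add_mem hx hy, g.2.1 x y⟩
  smul_mem' := by
    obtain ⟨g, hg, σ, hσ⟩ := g
    rintro a _ ⟨x, hx, rfl⟩
    refine ⟨σ.symm a • x, W.smul_mem _ hx, ?_⟩
    simp [hσ]

/-- `ΓL(V)` acts on the set of subspaces of `V` by `W ↦ g(W)`. -/
instance : MulAction (GammaL F V) (Submodule F V) where
  smul g W := GammaL.mapSubspace g W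
  one_smul _ := SetLike.coe_injective (Set.image_id _)
  mul_smul g h W := SetLike.coe_injective
    (Set.image_comp (g : Equiv.Perm V) (h : Equiv.Perm V) (W : Set V))

theorem GammaL.coe_smul (g : GammaL F V) (W : Submodule F V) :
    ((g • W : Submodule F V) : Set V) = (g : Equiv.Perm V) '' W := rfl

theorem scalarSubgroup_smul (g : GammaL F V) (hg : g ∈ scalarSubgroup F V)
    (W : Submodule F V) : g • W = W := by
  obtain ⟨c, hc⟩ := hg
  apply SetLike.coe_injective
  rw [GammaL.coe_smul]
  ext v
  constructor
  · rintro ⟨x, hx, rfl⟩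
    rw [hc]
    exact W.smul_mem _ hx
  · intro hv
    refine ⟨(c⁻¹ : Fˣ).val • v, W.smul_mem _ hv, ?_⟩
    rw [hc, smul_smul, Units.mul_inv, one_smul]

/-- The induced action of `PΓL(V)` on the set of subspaces of `V`. -/
instance : MulAction (PGammaL F V) (Submodule F V) :=
  MulAction.compHom (Submodule F V)
    (QuotientGroup.lift (scalarSubgroup F V)
      (MulAction.toPermHom (GammaL F V) (Submodule F V))
      (fun g hg => Equiv.ext (scalarSubgroup_smul g hg)) :
        PGammaL F V →* Equiv.Perm (Submodule F V))

theorem PGammaL.mk_smul (g : GammaL F V) (W : Submodule F V) :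
    PGammaL.mk g • W = g • W := rfl

end Semilinear

/-! ### Attenuated spaces -/

section Attenuated

variable (F : Type*) [Field F] (n l : ℕ)

/-- The subspace `E` of `F^(n+l)` spanned by the last `l` standard basis vectors. -/
def subspaceE : Submodule F (Fin (n + l) → F) :=
  Submodule.span F (Set.range fun i : Fin l => Pi.single (Fin.natAdd n i) (1 : F))

/-- The set `X_m` of all subspaces of type `(m, 0)`: `m`-dimensional subspaces `P` with
`dim (P ∩ E) = 0`. -/
def attX (m : ℕ) : Set (Submodule F (Fin (n + l) → F)) :=
  {P | Module.finrank F P = m ∧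
    Module.finrank F (P ⊓ subspaceE F n l : Submodule F (Fin (n + l) → F)) = 0}

variable {F n l}

/-- The row space `P'` of the first `n` columns of a matrix representing `P`, i.e. the image of
`P` under the projection of `F^(n+l)` to the first `n` coordinates. -/
def firstPart (P : Submodule F (Fin (n + l) → F)) : Submodule F (Fin n → F) :=
  P.map (LinearMap.funLeft F F (Fin.castAdd l))

/-- The relation `R_{i,k}` on `X_m`: `dim (P' ∩ Q') = m - i` and `dim (P ∩ Q) = m - (i + k)`. -/
def attRel (m i k : ℕ) (P Q : attX F n l m) : Prop :=
  Module.finrank F (firstPart P.1 ⊓ firstPart Q.1 : Submodule F (Fin n → F)) + i = m ∧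
  Module.finrank F (P.1 ⊓ Q.1 : Submodule F (Fin (n + l) → F)) + (i + k) = m

variable (F n l)

/-- The graph `Γ^(m) = (X_m, R_{1,0})`. -/
def attGraph (m : ℕ) : SimpleGraph (attX F n l m) where
  Adj := attRel m 1 0
  symm := ⟨fun P Q h => by
    unfold attRel at h ⊢
    rwa [inf_comm, inf_comm Q.1 P.1]⟩
  loopless := ⟨fun P h => by
    have h1 := h.2
    rw [inf_idem, P.2.1] at h1
    omega⟩

/-- `PΓL(n+l, F)_E`: the stabilizer of the subspace `E` in `PΓL(F^(n+l))`. -/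
abbrev PGammaLStabE : Subgroup (PGammaL F (Fin (n + l) → F)) :=
  MulAction.stabilizer (PGammaL F (Fin (n + l) → F)) (subspaceE F n l)

end Attenuated

/-!
The subspaces of type `(m, 0)` are the `m`-dimensional transversals of `E`, and two of them are
adjacent exactly when their span is an `(m + 1)`-dimensional transversal. Non-adjacent `P ≠ Q`
meet in dimension `m - 1` if and only if their common neighbours contain a diamond, that is `K₄`
minus an edge: if `P ⊓ Q` is a hyperplane, extending it by vectors outside `P ⊔ E` gives a
diamond, whereas if it is smaller, all common neighbours of `P` and `Q` adjacent to two given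
adjacent ones `R`, `S` lie in `R ⊔ S` and so are pairwise adjacent. Hence an automorphism
preserves intersections of dimension `m - 1`, permutes the stars of the `(m - 1)`-dimensional
transversals, and descends to an automorphism of the graph of these, compatibly with inclusion.

Repeating this, one arrives at a collineation of the points and lines that avoid `E`. Choosing
representatives `a x` of the image points so that `x + v` is sent to the point of `a v + a x`, for
a fixed `v ∉ E`, makes `a` additive off `H = E ⊔ ⟨v⟩`. Its additive extension to the whole space
is semilinear because it maps lines through the origin into such lines. A semilinear map fixing
every vertex fixes every point off `E`, since a transversal is the intersection of its star, and
is then a scalar.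
-/

open Module Submodule

/-! ### Linear algebra -/

section LinearAlgebra

variable {F V : Type*} [Field F] [AddCommGroup V] [Module F V] {A B H P : Submodule F V} {x y : V}

theorem mem_sup_span_singleton_iff : y ∈ H ⊔ span F {x} ↔ ∃ c : F, y - c • x ∈ H := by
  rw [mem_sup]
  constructor
  · rintro ⟨w, hw, _, hz, rfl⟩
    obtain ⟨c, rfl⟩ := mem_span_singleton.1 hz
    exact ⟨c, by rwa [add_sub_cancel_right]⟩
  · rintro ⟨c, hc⟩
    exact ⟨_, hc, c • x, smul_mem _ _ (mem_span_singleton_self x), sub_add_cancel y _⟩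

theorem notMem_sup_span_symm (hx : x ∉ H) (hy : y ∉ H ⊔ span F {x}) : x ∉ H ⊔ span F {y} := by
  intro h
  obtain ⟨d, hd⟩ := mem_sup_span_singleton_iff.1 h
  rcases eq_or_ne d 0 with rfl | hd0
  · exact hx (by simpa only [zero_smul, sub_zero] using hd)
  · refine hy ((smul_mem_iff _ hd0).1 ?_)
    have := sub_mem (mem_sup_right (mem_span_singleton_self x) : x ∈ H ⊔ span F {x})
      (mem_sup_left hd)
    rwa [sub_sub_cancel] at this

theorem linearIndependent_pair_of_notMem_sup (hx : x ∉ H) (hy : y ∉ H ⊔ span F {x}) :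
    LinearIndependent F ![x, y] :=
  (LinearIndependent.pair_iff' fun h : x = 0 => hx (h ▸ zero_mem H)).2 fun c hc =>
    hy (mem_sup_right (mem_span_singleton.2 ⟨c, hc⟩))

theorem inf_sup_span_singleton_le (hx : x ∉ A ⊔ B) :
    A ⊓ (B ⊔ span F {x}) ≤ B := by
  rintro t ⟨htA, ht⟩
  obtain ⟨c, hc⟩ := mem_sup_span_singleton_iff.1 ht
  rcases eq_or_ne c 0 with rfl | hc0
  · simpa only [zero_smul, sub_zero] using hc
  · refine absurd ((smul_mem_iff _ hc0).1 ?_) hx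
    simpa only [sub_sub_cancel] using
      sub_mem (mem_sup_left htA : t ∈ A ⊔ B) (mem_sup_right hc)

theorem exists_notMem_and_notMem (hA : A ≠ ⊤) (hB : B ≠ ⊤) : ∃ x, x ∉ A ∧ x ∉ B := by
  obtain ⟨a, ha⟩ := SetLike.exists_not_mem_of_ne_top A hA
  obtain ⟨b, hb⟩ := SetLike.exists_not_mem_of_ne_top B hB
  by_cases haB : a ∈ B
  · by_cases hbA : b ∈ A
    · exact ⟨a + b, fun h => ha ((A.add_mem_iff_left hbA).1 h),
        fun h => hb ((B.add_mem_iff_right haB).1 h)⟩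
    · exact ⟨b, hbA, hb⟩
  · exact ⟨a, ha, haB⟩

theorem ne_top_of_finrank_lt (h : finrank F H < finrank F V) : H ≠ ⊤ := by
  rintro rfl
  exact h.ne (finrank_top F V)

theorem exists_notMem_of_finrank_lt (h : finrank F H < finrank F V) : ∃ x, x ∉ H :=
  SetLike.exists_not_mem_of_ne_top H (ne_top_of_finrank_lt h)

variable [FiniteDimensional F V]

theorem finrank_sup_span_singleton_le (H : Submodule F V) (x : V) :
    finrank F (H ⊔ span F {x} : Submodule F V) ≤ finrank F H + 1 :=
  (finrank_add_le_finrank_add_finrank _ _).trans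
    (Nat.add_le_add_left ((finrank_span_le_card _).trans (by simp)) _)

theorem finrank_lt_finrank_sup (h : ¬ B ≤ A) : finrank F A < finrank F (A ⊔ B : Submodule F V) :=
  finrank_lt_finrank_of_lt (left_lt_sup.2 h)

theorem sup_eq_of_finrank {k : ℕ} (hA : A ≤ P) (hB : B ≤ P) (hP : finrank F P = k + 1)
    (hAk : finrank F A = k) (hBk : finrank F B = k) (hne : A ≠ B) : A ⊔ B = P := by
  refine eq_of_le_of_finrank_le (sup_le hA hB) ?_
  have := finrank_lt_finrank_sup fun h : B ≤ A =>
    hne (eq_of_le_of_finrank_eq h (hBk.trans hAk.symm)).symm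
  omega

theorem exists_le_le_finrank_eq (hAP : A ≤ P) {j : ℕ} (hA : finrank F A ≤ j)
    (hP : j ≤ finrank F P) : ∃ B, A ≤ B ∧ B ≤ P ∧ finrank F B = j := by
  induction j, hA using Nat.le_induction with
  | base => exact ⟨A, le_rfl, hAP, rfl⟩
  | succ j _ ih =>
    obtain ⟨B, hAB, hBP, hB⟩ := ih (by omega)
    obtain ⟨x, hxP, hxB⟩ : ∃ x ∈ P, x ∉ B :=
      SetLike.exists_of_lt (lt_of_le_of_ne hBP (by rintro rfl; omega))
    exact ⟨B ⊔ span F {x}, hAB.trans le_sup_left,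
      sup_le hBP ((span_singleton_le_iff_mem _ _).2 hxP),
      by rw [finrank_sup_span_singleton hxB, hB]⟩

end LinearAlgebra

/-! ### Transversals and their graph -/

section Transversal

variable {F V : Type*} [Field F] [AddCommGroup V] [Module F V]

/-- The `m`-dimensional subspaces that meet `E` trivially, i.e. the subspaces of type `(m, 0)`. -/
def transversals (E : Submodule F V) (m : ℕ) : Set (Submodule F V) :=
  {P | finrank F P = m ∧ Disjoint P E}

variable {E P Q U W : Submodule F V} {k m : ℕ} {x : V}

theorem transversals_of_le (hP : P ∈ transversals E m) (hU : U ≤ P) (h : finrank F U = k) :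
    U ∈ transversals E k :=
  ⟨h, hP.2.mono_left hU⟩

theorem bot_mem_transversals : ⊥ ∈ transversals E 0 :=
  ⟨finrank_bot F V, disjoint_bot_left⟩

theorem add_notMem_of_mem_transversals (hW : W ∈ transversals E m) {e : V} (he : e ∈ E)
    (he0 : e ≠ 0) (hx : x ∈ W) : x + e ∉ W := fun h =>
  he0 (disjoint_def.1 hW.2 e ((W.add_mem_iff_right hx).1 h) he)

theorem notMem_sup_of_le (hUP : U ≤ P) (hx : x ∉ P ⊔ E) : x ∉ U ⊔ E := fun h =>
  hx (sup_le_sup_right hUP E h)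

theorem notMem_sup_of_mem (hP : P ∈ transversals E m) (hUP : U ≤ P) (hx : x ∈ P)
    (hxU : x ∉ U) : x ∉ U ⊔ E := by
  intro h
  obtain ⟨u, hu, e, he, rfl⟩ := mem_sup.1 h
  have h0 := disjoint_def.1 hP.2 e ((P.add_mem_iff_right (hUP hu)).1 hx) he
  exact hxU (by rwa [h0, add_zero])

variable [FiniteDimensional F V]

theorem finrank_sup_le_of_mem (hP : P ∈ transversals E m) :
    finrank F (P ⊔ E : Submodule F V) ≤ m + finrank F E :=
  hP.1 ▸ finrank_add_le_finrank_add_finrank P E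

theorem sup_span_mem_transversals (hU : U ∈ transversals E k) (hx : x ∉ U ⊔ E) :
    U ⊔ span F {x} ∈ transversals E (k + 1) := by
  refine ⟨by rw [finrank_sup_span_singleton fun h => hx (mem_sup_left h), hU.1], ?_⟩
  have hd : Disjoint (span F {x}) (U ⊔ E) := (disjoint_span_singleton_of_notMem hx).symm
  rw [sup_comm]
  exact Disjoint.disjoint_sup_left_of_disjoint_sup_right hU.2 hd

theorem eq_of_le_of_mem_transversals (hP : P ∈ transversals E m) (hQ : Q ∈ transversals E m)
    (h : P ≤ Q) : P = Q :=
  eq_of_le_of_finrank_eq h (hP.1.trans hQ.1.symm)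

theorem finrank_inf_le_of_ne (hP : P ∈ transversals E (k + 1)) (hQ : Q ∈ transversals E (k + 1))
    (hne : P ≠ Q) : finrank F (P ⊓ Q : Submodule F V) ≤ k := by
  have hlt : P ⊓ Q < P := inf_lt_left.2 fun h => hne (eq_of_le_of_mem_transversals hP hQ h)
  have := finrank_lt_finrank_of_lt hlt
  rw [hP.1] at this
  omega

theorem inf_eq_of_le (hU : U ∈ transversals E k) (hP : P ∈ transversals E (k + 1))
    (hQ : Q ∈ transversals E (k + 1)) (hne : P ≠ Q) (hUP : U ≤ P) (hUQ : U ≤ Q) : P ⊓ Q = U :=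
  (eq_of_le_of_finrank_le (le_inf hUP hUQ) (hU.1 ▸ finrank_inf_le_of_ne hP hQ hne)).symm

theorem sup_mem_transversals_iff (hP : P ∈ transversals E m) (hQ : Q ∈ transversals E m) :
    P ⊔ Q ∈ transversals E (m + 1) ↔ P ≠ Q ∧ ∃ W ∈ transversals E (m + 1), P ≤ W ∧ Q ≤ W := by
  constructor
  · refine fun h => ⟨?_, _, h, le_sup_left, le_sup_right⟩
    rintro rfl
    have := h.1
    rw [sup_idem, hP.1] at this
    omega
  · rintro ⟨hne, W, hW, hPW, hQW⟩
    refine transversals_of_le hW (sup_le hPW hQW) (le_antisymm ?_ ?_)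
    · exact hW.1 ▸ finrank_mono (sup_le hPW hQW)
    · exact hP.1 ▸ finrank_lt_finrank_sup fun h => hne (eq_of_le_of_mem_transversals hQ hP h).symm

theorem finrank_inf_of_sup_mem (hP : P ∈ transversals E (k + 1)) (hQ : Q ∈ transversals E (k + 1))
    (h : P ⊔ Q ∈ transversals E (k + 2)) : finrank F (P ⊓ Q : Submodule F V) = k := by
  have := finrank_sup_add_finrank_inf_eq P Q
  rw [hP.1, hQ.1, h.1] at this
  omega

/-- Two transversals are adjacent when their span is a transversal of dimension one more; this is
the relation `R_{1,0}`. -/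
def transversalGraph (E : Submodule F V) (m : ℕ) : SimpleGraph (transversals E m) where
  Adj P Q := P.1 ⊔ Q.1 ∈ transversals E (m + 1)
  symm := ⟨fun P Q h => by rwa [sup_comm]⟩
  loopless := ⟨fun P h => ((sup_mem_transversals_iff P.2 P.2).1 h).1 rfl⟩

/-- The transversal spanned by a transversal `U` and a vector `x` outside `U ⊔ E`. -/
def extend (U : transversals E k) (x : V) (hx : x ∉ U.1 ⊔ E) : transversals E (k + 1) :=
  ⟨U.1 ⊔ span F {x}, sup_span_mem_transversals U.2 hx⟩

theorem le_extend (U : transversals E k) (hx : x ∉ U.1 ⊔ E) : U.1 ≤ (extend U x hx).1 :=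
  le_sup_left

theorem mem_extend (U : transversals E k) (hx : x ∉ U.1 ⊔ E) : x ∈ (extend U x hx).1 :=
  mem_sup_right (mem_span_singleton_self x)

theorem adj_extend {U : transversals E k} {P : transversals E (k + 1)} (hUP : U.1 ≤ P.1)
    (hx : x ∉ P.1 ⊔ E) :
    (transversalGraph E (k + 1)).Adj P (extend U x (notMem_sup_of_le hUP hx)) := by
  change P.1 ⊔ (U.1 ⊔ span F {x}) ∈ transversals E (k + 2)
  rw [← sup_assoc, sup_eq_left.2 hUP]
  exact sup_span_mem_transversals P.2 hx

theorem extend_ne_extend_add {U : transversals E k} {e : V} (he : e ∈ E) (he0 : e ≠ 0)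
    (hx : x ∉ U.1 ⊔ E) (hxe : x + e ∉ U.1 ⊔ E) : extend U x hx ≠ extend U (x + e) hxe := fun h =>
  add_notMem_of_mem_transversals (extend U x hx).2 he he0 (mem_extend U hx) (h ▸ mem_extend U hxe)

theorem not_adj_extend_add {U : transversals E k} {e : V} (he : e ∈ E) (he0 : e ≠ 0)
    (hx : x ∉ U.1 ⊔ E) (hxe : x + e ∉ U.1 ⊔ E) :
    ¬ (transversalGraph E (k + 1)).Adj (extend U x hx) (extend U (x + e) hxe) := fun h =>
  add_notMem_of_mem_transversals h he he0 (mem_sup_left (mem_extend U hx))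
    (mem_sup_right (mem_extend U hxe))

theorem exists_eq_extend {U : transversals E k} {P : transversals E (k + 1)} (h : U.1 ≤ P.1) :
    ∃ x, ∃ hx : x ∉ U.1 ⊔ E, P = extend U x hx := by
  obtain ⟨x, hxP, hxU⟩ : ∃ x ∈ P.1, x ∉ U.1 := SetLike.exists_of_lt (lt_of_le_of_ne h fun e => by
    have := U.2.1; have := P.2.1; rw [e] at *; omega)
  have hx := notMem_sup_of_mem P.2 h hxP hxU
  exact ⟨x, hx, Subtype.ext (eq_of_le_of_mem_transversals (extend U x hx).2 P.2
    (sup_le h ((span_singleton_le_iff_mem _ _).2 hxP))).symm⟩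

theorem span_singleton_mem_transversals (hx : x ∉ E) : span F {x} ∈ transversals E 1 := by
  have := sup_span_mem_transversals (bot_mem_transversals (E := E)) (x := x) (by rwa [bot_sup_eq])
  rwa [bot_sup_eq] at this

/-- The one-dimensional transversal spanned by a vector outside `E`. -/
def point (x : V) (hx : x ∉ E) : transversals E 1 :=
  ⟨span F {x}, span_singleton_mem_transversals hx⟩

theorem exists_eq_point (p : transversals E 1) : ∃ x, ∃ hx : x ∉ E, p = point x hx := by
  obtain ⟨x, hx, h⟩ := exists_eq_extend (U := ⟨⊥, bot_mem_transversals⟩) (P := p) bot_le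
  exact ⟨x, by rwa [bot_sup_eq] at hx, Subtype.ext ((congrArg Subtype.val h).trans (bot_sup_eq _))⟩

theorem span_singleton_sup_mem_transversals_iff {y : V} (hx : x ∉ E) :
    span F {x} ⊔ span F {y} ∈ transversals E 2 ↔ y ∉ E ⊔ span F {x} := by
  have hxE := span_singleton_mem_transversals (F := F) hx
  rw [sup_comm E]
  refine ⟨fun h => notMem_sup_of_mem h le_sup_left
    (mem_sup_right (mem_span_singleton_self y)) fun hy => ?_, sup_span_mem_transversals hxE⟩
  rw [sup_eq_left.2 ((span_singleton_le_iff_mem _ _).2 hy)] at h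
  exact absurd (h.1.symm.trans hxE.1) (by decide)

theorem exists_inf_eq (hE : E ≠ ⊥) (h : k + 1 + finrank F E ≤ finrank F V)
    (U : transversals E k) : ∃ P S : transversals E (k + 1), P ≠ S ∧
      ¬ (transversalGraph E (k + 1)).Adj P S ∧ P.1 ⊓ S.1 = U.1 := by
  have := finrank_sup_le_of_mem U.2
  obtain ⟨x, hx⟩ := exists_notMem_of_finrank_lt (H := U.1 ⊔ E) (by omega)
  obtain ⟨e, he, he0⟩ := exists_mem_ne_zero_of_ne_bot hE
  have hxe : x + e ∉ U.1 ⊔ E := by rwa [Submodule.add_mem_iff_left _ (mem_sup_right he)]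
  have hne := extend_ne_extend_add he he0 hx hxe
  exact ⟨_, _, hne, not_adj_extend_add he he0 hx hxe,
    inf_eq_of_le U.2 (extend U x hx).2 (extend U _ hxe).2 (Subtype.coe_injective.ne hne)
      le_sup_left le_sup_left⟩

end Transversal

/-! ### Recognising hyperplane intersections in the graph -/

section Diamond

/-- The vertices `r`, `s`, `a`, `b` span a complete graph with the edge `ab` removed. -/
def IsDiamond {α : Type*} (G : SimpleGraph α) (r s a b : α) : Prop :=
  G.Adj r s ∧ a ∈ G.commonNeighbors r s ∧ b ∈ G.commonNeighbors r s ∧ a ≠ b ∧ ¬ G.Adj a b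

/-- Among the common neighbours of `u` and `v` there is a diamond. In the graph of transversals this
singles out, among the non-adjacent pairs, those that meet in a hyperplane. -/
def SharesDiamond {α : Type*} (G : SimpleGraph α) (u v : α) : Prop :=
  ∃ r s a b, IsDiamond G r s a b ∧ {r, s, a, b} ⊆ G.commonNeighbors u v

theorem SharesDiamond.map {α β : Type*} {G : SimpleGraph α} {G' : SimpleGraph β} (τ : G ≃g G')
    {u v : α} (h : SharesDiamond G u v) : SharesDiamond G' (τ u) (τ v) := by
  obtain ⟨r, s, a, b, ⟨hrs, ha, hb, hne, hab⟩, hsub⟩ := h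
  refine ⟨τ r, τ s, τ a, τ b, ⟨τ.map_adj_iff.2 hrs, ?_, ?_, τ.injective.ne hne, ?_⟩, ?_⟩
  · exact ⟨τ.map_adj_iff.2 ha.1, τ.map_adj_iff.2 ha.2⟩
  · exact ⟨τ.map_adj_iff.2 hb.1, τ.map_adj_iff.2 hb.2⟩
  · exact fun h => hab (τ.map_adj_iff.1 h)
  · have : ({τ r, τ s, τ a, τ b} : Set β) = τ '' {r, s, a, b} := by
      simp only [Set.image_insert_eq, Set.image_singleton]
    rw [this]
    rintro _ ⟨t, ht, rfl⟩
    exact ⟨τ.map_adj_iff.2 (hsub ht).1, τ.map_adj_iff.2 (hsub ht).2⟩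

variable {F V : Type*} [Field F] [AddCommGroup V] [Module F V] [FiniteDimensional F V]
  {E : Submodule F V} {k : ℕ} {x y : V}

theorem isDiamond_extend {U : transversals E k} {e : V} (he : e ∈ E) (he0 : e ≠ 0)
    (hx : x ∉ U.1 ⊔ E) (hy : y ∉ U.1 ⊔ E) (hyx : y ∉ U.1 ⊔ E ⊔ span F {x})
    (hz : x + y ∉ U.1 ⊔ E) (hw : x + y + e ∉ U.1 ⊔ E) :
    IsDiamond (transversalGraph E (k + 1)) (extend U x hx) (extend U y hy) (extend U (x + y) hz)
      (extend U (x + y + e) hw) := by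
  have hxy := notMem_sup_span_symm hx hyx
  rw [sup_right_comm] at hyx hxy
  have hzx : x + y ∉ (extend U x hx).1 ⊔ E := fun h =>
    hyx ((Submodule.add_mem_iff_right _ (mem_sup_left (mem_extend U hx))).1 h)
  have hzy : x + y ∉ (extend U y hy).1 ⊔ E := fun h =>
    hxy ((Submodule.add_mem_iff_left _ (mem_sup_left (mem_extend U hy))).1 h)
  refine ⟨adj_extend (le_extend U hx) hyx, ⟨adj_extend (le_extend U hx) hzx,
    adj_extend (le_extend U hy) hzy⟩, ⟨adj_extend (le_extend U hx) ?_,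
    adj_extend (le_extend U hy) ?_⟩, extend_ne_extend_add he he0 hz hw,
    not_adj_extend_add he he0 hz hw⟩
  · rwa [Submodule.add_mem_iff_left _ (mem_sup_right he)]
  · rwa [Submodule.add_mem_iff_left _ (mem_sup_right he)]

theorem le_sup_of_not_adj {P Q : transversals E (k + 1)}
    (hadj : ¬ (transversalGraph E (k + 1)).Adj P Q)
    (h : finrank F (P.1 ⊓ Q.1 : Submodule F V) = k) : Q.1 ≤ P.1 ⊔ E := by
  intro x hxQ
  by_contra hx
  have hle : P.1 ⊔ span F {x} ≤ P.1 ⊔ Q.1 :=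
    sup_le_sup_left ((span_singleton_le_iff_mem _ _).2 hxQ) _
  have hmem := sup_span_mem_transversals P.2 hx
  have hdim := finrank_sup_add_finrank_inf_eq P.1 Q.1
  rw [P.2.1, Q.2.1, h] at hdim
  refine hadj (?_ : P.1 ⊔ Q.1 ∈ transversals E (k + 2))
  rwa [← eq_of_le_of_finrank_eq hle (by rw [hmem.1]; omega)]

theorem extend_mem_commonNeighbors {P Q : transversals E (k + 1)} {U : transversals E k}
    (hadj : ¬ (transversalGraph E (k + 1)).Adj P Q) (hU : P.1 ⊓ Q.1 = U.1)
    (hx : x ∉ P.1 ⊔ E) (hxU : x ∉ U.1 ⊔ E) :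
    extend U x hxU ∈ (transversalGraph E (k + 1)).commonNeighbors P Q := by
  have hPQ : Q.1 ⊔ E ≤ P.1 ⊔ E := sup_le (le_sup_of_not_adj hadj (hU ▸ U.2.1)) le_sup_right
  exact ⟨adj_extend (hU ▸ inf_le_left) hx, adj_extend (hU ▸ inf_le_right) fun h => hx (hPQ h)⟩

theorem sharesDiamond_of_finrank_inf (hE : E ≠ ⊥) (hn : k + 3 + finrank F E ≤ finrank F V)
    {P Q : transversals E (k + 1)} (hadj : ¬ (transversalGraph E (k + 1)).Adj P Q)
    (h : finrank F (P.1 ⊓ Q.1 : Submodule F V) = k) :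
    SharesDiamond (transversalGraph E (k + 1)) P Q := by
  obtain ⟨U, hU⟩ : ∃ U : transversals E k, P.1 ⊓ Q.1 = U.1 :=
    ⟨⟨_, transversals_of_le P.2 inf_le_left h⟩, rfl⟩
  have hUP : U.1 ⊔ E ≤ P.1 ⊔ E := sup_le_sup_right (hU ▸ inf_le_left) E
  have hP := finrank_sup_le_of_mem P.2
  obtain ⟨x, hx⟩ := exists_notMem_of_finrank_lt (H := P.1 ⊔ E) (by omega)
  have hPx := finrank_sup_span_singleton_le (P.1 ⊔ E) x
  obtain ⟨y, hyx⟩ := exists_notMem_of_finrank_lt (H := P.1 ⊔ E ⊔ span F {x}) (by omega)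
  obtain ⟨e, he, he0⟩ := exists_mem_ne_zero_of_ne_bot hE
  have hy : y ∉ P.1 ⊔ E := fun h => hyx (mem_sup_left h)
  have hz : x + y ∉ P.1 ⊔ E := fun h => hyx
    ((Submodule.add_mem_iff_right _ (mem_sup_right (mem_span_singleton_self x))).1 (mem_sup_left h))
  have hw : x + y + e ∉ P.1 ⊔ E := by rwa [Submodule.add_mem_iff_left _ (mem_sup_right he)]
  refine ⟨_, _, _, _, isDiamond_extend he he0 (fun h => hx (hUP h)) (fun h => hy (hUP h))
    (fun h => hyx (sup_le_sup_right hUP _ h)) (fun h => hz (hUP h)) (fun h => hw (hUP h)), ?_⟩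
  rintro _ (rfl | rfl | rfl | rfl)
  · exact extend_mem_commonNeighbors hadj hU hx _
  · exact extend_mem_commonNeighbors hadj hU hy _
  · exact extend_mem_commonNeighbors hadj hU hz _
  · exact extend_mem_commonNeighbors hadj hU hw _

variable {P Q R S T : transversals E (k + 1)}

theorem inf_sup_inf_eq_of_mem_commonNeighbors (h : finrank F (P.1 ⊓ Q.1 : Submodule F V) < k)
    (hR : R ∈ (transversalGraph E (k + 1)).commonNeighbors P Q) :
    (P.1 ⊓ R.1) ⊔ (Q.1 ⊓ R.1) = R.1 := by
  have hPR := finrank_inf_of_sup_mem P.2 R.2 hR.1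
  refine sup_eq_of_finrank inf_le_right inf_le_right R.2.1 hPR
    (finrank_inf_of_sup_mem Q.2 R.2 hR.2) fun heq => ?_
  have : P.1 ⊓ R.1 ≤ P.1 ⊓ Q.1 := le_inf inf_le_left (heq ▸ inf_le_left)
  have := finrank_mono this
  omega

theorem inf_eq_or_inf_eq_of_adj (h : finrank F (P.1 ⊓ Q.1 : Submodule F V) < k)
    (hR : R ∈ (transversalGraph E (k + 1)).commonNeighbors P Q)
    (hS : S ∈ (transversalGraph E (k + 1)).commonNeighbors P Q)
    (hRS : (transversalGraph E (k + 1)).Adj R S) :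
    P.1 ⊓ R.1 = P.1 ⊓ S.1 ∨ Q.1 ⊓ R.1 = Q.1 ⊓ S.1 := by
  by_contra! hne
  have hP : P.1 ≤ R.1 ⊔ S.1 := (sup_eq_of_finrank inf_le_left inf_le_left P.2.1
    (finrank_inf_of_sup_mem P.2 R.2 hR.1) (finrank_inf_of_sup_mem P.2 S.2 hS.1) hne.1).ge.trans
    (sup_le_sup inf_le_right inf_le_right)
  have hQ : Q.1 ≤ R.1 ⊔ S.1 := (sup_eq_of_finrank inf_le_left inf_le_left Q.2.1
    (finrank_inf_of_sup_mem Q.2 R.2 hR.2) (finrank_inf_of_sup_mem Q.2 S.2 hS.2) hne.2).ge.trans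
    (sup_le_sup inf_le_right inf_le_right)
  have hle := finrank_mono (sup_le hP hQ)
  have hdim := finrank_sup_add_finrank_inf_eq P.1 Q.1
  rw [P.2.1, Q.2.1] at hdim
  rw [(show R.1 ⊔ S.1 ∈ transversals E (k + 2) from hRS).1] at hle
  omega

theorem le_sup_of_inf_eq (h : finrank F (P.1 ⊓ Q.1 : Submodule F V) < k)
    (hR : R ∈ (transversalGraph E (k + 1)).commonNeighbors P Q)
    (hS : S ∈ (transversalGraph E (k + 1)).commonNeighbors P Q)
    (hT : T ∈ (transversalGraph E (k + 1)).commonNeighbors P Q)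
    (hRS : (transversalGraph E (k + 1)).Adj R S)
    (hTRS : T ∈ (transversalGraph E (k + 1)).commonNeighbors R S)
    (hP : P.1 ⊓ R.1 = P.1 ⊓ S.1) : T.1 ≤ R.1 ⊔ S.1 := by
  have hQ : Q.1 ⊓ R.1 ≠ Q.1 ⊓ S.1 := fun hQ => hRS.ne <| Subtype.ext <| by
    rw [← inf_sup_inf_eq_of_mem_commonNeighbors h hR, hP, hQ,
      inf_sup_inf_eq_of_mem_commonNeighbors h hS]
  have hPT : P.1 ⊓ T.1 = P.1 ⊓ R.1 := by
    rcases inf_eq_or_inf_eq_of_adj h hR hT hTRS.1 with h' | hQR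
    · exact h'.symm
    · rcases inf_eq_or_inf_eq_of_adj h hS hT hTRS.2 with h' | hQS
      · exact (hP.trans h').symm
      · exact absurd (hQR.trans hQS.symm) hQ
  have hQ' : (Q.1 ⊓ R.1) ⊔ (Q.1 ⊓ S.1) = Q.1 := sup_eq_of_finrank inf_le_left inf_le_left Q.2.1
    (finrank_inf_of_sup_mem Q.2 R.2 hR.2) (finrank_inf_of_sup_mem Q.2 S.2 hS.2) hQ
  calc T.1 = (P.1 ⊓ T.1) ⊔ (Q.1 ⊓ T.1) := (inf_sup_inf_eq_of_mem_commonNeighbors h hT).symm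
    _ ≤ (P.1 ⊓ R.1) ⊔ ((Q.1 ⊓ R.1) ⊔ (Q.1 ⊓ S.1)) :=
      sup_le_sup hPT.le (inf_le_left.trans hQ'.ge)
    _ ≤ R.1 ⊔ S.1 := sup_le (inf_le_right.trans le_sup_left) (sup_le_sup inf_le_right inf_le_right)

theorem le_sup_of_mem_commonNeighbors (h : finrank F (P.1 ⊓ Q.1 : Submodule F V) < k)
    (hR : R ∈ (transversalGraph E (k + 1)).commonNeighbors P Q)
    (hS : S ∈ (transversalGraph E (k + 1)).commonNeighbors P Q)
    (hT : T ∈ (transversalGraph E (k + 1)).commonNeighbors P Q)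
    (hRS : (transversalGraph E (k + 1)).Adj R S)
    (hTRS : T ∈ (transversalGraph E (k + 1)).commonNeighbors R S) : T.1 ≤ R.1 ⊔ S.1 := by
  rcases inf_eq_or_inf_eq_of_adj h hR hS hRS with hP | hQ
  · exact le_sup_of_inf_eq h hR hS hT hRS hTRS hP
  · exact le_sup_of_inf_eq (by rwa [inf_comm]) hR.symm hS.symm hT.symm hRS hTRS hQ

theorem finrank_inf_of_sharesDiamond (hne : P ≠ Q)
    (h : SharesDiamond (transversalGraph E (k + 1)) P Q) :
    finrank F (P.1 ⊓ Q.1 : Submodule F V) = k := by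
  obtain ⟨R, S, A, B, ⟨hRS, hA, hB, hAB, hadj⟩, hsub⟩ := h
  simp only [Set.insert_subset_iff, Set.singleton_subset_iff] at hsub
  obtain ⟨hR, hS, hA', hB'⟩ := hsub
  refine (finrank_inf_le_of_ne P.2 Q.2 (Subtype.coe_injective.ne hne)).eq_of_not_lt fun hlt => ?_
  exact hadj ((sup_mem_transversals_iff A.2 B.2).2 ⟨Subtype.coe_injective.ne hAB, R.1 ⊔ S.1, hRS,
    le_sup_of_mem_commonNeighbors hlt hR hS hA' hRS hA,
    le_sup_of_mem_commonNeighbors hlt hR hS hB' hRS hB⟩)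

theorem finrank_inf_eq_iff (hE : E ≠ ⊥) (hn : k + 3 + finrank F E ≤ finrank F V) :
    finrank F (P.1 ⊓ Q.1 : Submodule F V) = k ↔
      P ≠ Q ∧ ((transversalGraph E (k + 1)).Adj P Q ∨
        SharesDiamond (transversalGraph E (k + 1)) P Q) := by
  constructor
  · refine fun h =>
      ⟨?_, or_iff_not_imp_left.2 fun hadj => sharesDiamond_of_finrank_inf hE hn hadj h⟩
    rintro rfl
    rw [inf_idem, P.2.1] at h
    omega
  · rintro ⟨hne, hadj | h⟩
    · exact finrank_inf_of_sup_mem P.2 Q.2 hadj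
    · exact finrank_inf_of_sharesDiamond hne h

theorem finrank_inf_map_eq_iff (hE : E ≠ ⊥) (hn : k + 3 + finrank F E ≤ finrank F V)
    (τ : transversalGraph E (k + 1) ≃g transversalGraph E (k + 1)) :
    finrank F ((τ P).1 ⊓ (τ Q).1 : Submodule F V) = k ↔
      finrank F (P.1 ⊓ Q.1 : Submodule F V) = k := by
  have hdia : SharesDiamond (transversalGraph E (k + 1)) (τ P) (τ Q) ↔
      SharesDiamond (transversalGraph E (k + 1)) P Q :=
    ⟨fun h => by simpa only [RelIso.symm_apply_apply] using h.map τ.symm, fun h => h.map τ⟩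
  rw [finrank_inf_eq_iff hE hn, finrank_inf_eq_iff hE hn, τ.injective.ne_iff, τ.map_adj_iff, hdia]

end Diamond

/-! ### Stars and descent to smaller transversals -/

section Star

variable {F V : Type*} [Field F] [AddCommGroup V] [Module F V] {E : Submodule F V} {k : ℕ}

/-- A map `β` on `k`-dimensional and a map `τ` on `(k + 1)`-dimensional transversals preserve and
reflect inclusion. -/
def PreservesIncidence (β : transversals E k → transversals E k)
    (τ : transversals E (k + 1) → transversals E (k + 1)) : Prop :=
  ∀ U T, (β U).1 ≤ (τ T).1 ↔ U.1 ≤ T.1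

variable [FiniteDimensional F V] {P R S T : transversals E (k + 1)}

theorem inf_le_of_mem_commonNeighbors (hadj : ¬ (transversalGraph E (k + 1)).Adj P S)
    (h : finrank F (P.1 ⊓ S.1 : Submodule F V) = k)
    (hR : R ∈ (transversalGraph E (k + 1)).commonNeighbors P S) : P.1 ⊓ S.1 ≤ R.1 := by
  have hPR := finrank_inf_of_sup_mem P.2 R.2 hR.1
  have hSR := finrank_inf_of_sup_mem S.2 R.2 hR.2
  by_cases heq : P.1 ⊓ R.1 = S.1 ⊓ R.1
  · have hle : P.1 ⊓ R.1 ≤ P.1 ⊓ S.1 := le_inf inf_le_left (heq ▸ inf_le_left)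
    rw [← eq_of_le_of_finrank_eq hle (hPR.trans h.symm)]
    exact inf_le_right
  · have hRPS : R.1 ≤ P.1 ⊔ S.1 :=
      (sup_eq_of_finrank inf_le_right inf_le_right R.2.1 hPR hSR heq).ge.trans
        (sup_le_sup inf_le_left inf_le_left)
    have hPRX : P.1 ⊔ R.1 ∈ transversals E (k + 2) := hR.1
    have hdim := finrank_sup_add_finrank_inf_eq P.1 S.1
    rw [P.2.1, S.2.1, h] at hdim
    refine absurd (?_ : P.1 ⊔ S.1 ∈ transversals E (k + 2)) hadj
    rwa [← eq_of_le_of_finrank_eq (sup_le le_sup_left hRPS) (by rw [hPRX.1]; omega)]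

theorem inf_le_of_forall_commonNeighbors (hn : k + 3 + finrank F E ≤ finrank F V)
    (hadj : ¬ (transversalGraph E (k + 1)).Adj P S)
    (h : finrank F (P.1 ⊓ S.1 : Submodule F V) = k)
    (hT : ∀ R ∈ (transversalGraph E (k + 1)).commonNeighbors P S,
      T = R ∨ finrank F (T.1 ⊓ R.1 : Submodule F V) = k) : P.1 ⊓ S.1 ≤ T.1 := by
  obtain ⟨U, hU⟩ : ∃ U : transversals E k, P.1 ⊓ S.1 = U.1 :=
    ⟨⟨_, transversals_of_le P.2 inf_le_left h⟩, rfl⟩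
  have hle : ∀ x, x ∉ P.1 ⊔ E → k ≤ finrank F (T.1 ⊓ (U.1 ⊔ span F {x}) : Submodule F V) := by
    intro x hx
    have hxU := notMem_sup_of_le (hU ▸ inf_le_left) hx
    rcases hT _ (extend_mem_commonNeighbors hadj hU hx hxU) with rfl | hTR
    · change k ≤ finrank F ((U.1 ⊔ span F {x}) ⊓ (U.1 ⊔ span F {x}) : Submodule F V)
      rw [inf_idem, (sup_span_mem_transversals U.2 hxU).1]
      exact k.le_succ
    · exact hTR.ge
  have hP : finrank F (P.1 ⊔ E : Submodule F V) < finrank F V := by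
    have := finrank_sup_le_of_mem P.2
    omega
  have hTU : finrank F (T.1 ⊔ U.1 : Submodule F V) < finrank F V := by
    obtain ⟨x, hx⟩ := exists_notMem_of_finrank_lt hP
    have hdim := finrank_sup_add_finrank_inf_eq (T.1 ⊓ (U.1 ⊔ span F {x})) U.1
    rw [inf_assoc, inf_eq_right.2 (le_sup_left : U.1 ≤ U.1 ⊔ span F {x}), U.2.1] at hdim
    have hsup := finrank_mono (sup_le inf_le_right le_sup_left :
      T.1 ⊓ (U.1 ⊔ span F {x}) ⊔ U.1 ≤ U.1 ⊔ span F {x})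
    have hUx := finrank_sup_span_singleton_le U.1 x
    have hdim' := finrank_sup_add_finrank_inf_eq T.1 U.1
    have := hle x hx
    rw [T.2.1, U.2.1] at hdim'
    rw [U.2.1] at hUx
    omega
  obtain ⟨x, hxP, hxTU⟩ :=
    exists_notMem_and_notMem (ne_top_of_finrank_lt hP) (ne_top_of_finrank_lt hTU)
  have hTxU : T.1 ⊓ (U.1 ⊔ span F {x}) ≤ U.1 := inf_sup_span_singleton_le hxTU
  rw [hU, ← eq_of_le_of_finrank_le hTxU (U.2.1.trans_le (hle x hxP))]
  exact inf_le_left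

theorem inf_le_iff_forall_commonNeighbors (hn : k + 3 + finrank F E ≤ finrank F V)
    (hadj : ¬ (transversalGraph E (k + 1)).Adj P S)
    (h : finrank F (P.1 ⊓ S.1 : Submodule F V) = k) :
    P.1 ⊓ S.1 ≤ T.1 ↔ ∀ R ∈ (transversalGraph E (k + 1)).commonNeighbors P S,
      T = R ∨ finrank F (T.1 ⊓ R.1 : Submodule F V) = k := by
  refine ⟨fun hT R hR => or_iff_not_imp_left.2 fun hTR => ?_,
    inf_le_of_forall_commonNeighbors hn hadj h⟩
  rw [inf_eq_of_le (transversals_of_le P.2 inf_le_left h) T.2 R.2 (Subtype.coe_injective.ne hTR) hT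
    (inf_le_of_mem_commonNeighbors hadj h hR), h]

theorem exists_star_image (hE : E ≠ ⊥) (hn : k + 3 + finrank F E ≤ finrank F V)
    (τ : transversalGraph E (k + 1) ≃g transversalGraph E (k + 1)) :
    ∃ β : transversals E k → transversals E k, PreservesIncidence β τ := by
  suffices ∀ U : transversals E k, ∃ U' : transversals E k, ∀ T, U'.1 ≤ (τ T).1 ↔ U.1 ≤ T.1 from
    Classical.skolem.1 this
  intro U
  obtain ⟨P, S, -, hadj, hPS⟩ := exists_inf_eq hE (by omega) U
  have h : finrank F (P.1 ⊓ S.1 : Submodule F V) = k := hPS ▸ U.2.1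
  have h' := (finrank_inf_map_eq_iff hE hn τ).2 h
  refine ⟨⟨_, transversals_of_le (τ P).2 inf_le_left h'⟩, fun T => ?_⟩
  rw [← hPS, inf_le_iff_forall_commonNeighbors hn (fun h => hadj (τ.map_adj_iff.1 h)) h',
    inf_le_iff_forall_commonNeighbors hn hadj h, τ.surjective.forall]
  simp only [SimpleGraph.mem_commonNeighbors, τ.map_adj_iff, τ.injective.eq_iff,
    finrank_inf_map_eq_iff hE hn τ]

theorem eq_of_star_le (hE : E ≠ ⊥) (hn : k + 1 + finrank F E ≤ finrank F V)
    {U U' : transversals E k} (h : ∀ T : transversals E (k + 1), U.1 ≤ T.1 → U'.1 ≤ T.1) :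
    U' = U := by
  obtain ⟨P, S, -, -, hPS⟩ := exists_inf_eq hE hn U
  refine Subtype.ext (eq_of_le_of_mem_transversals U'.2 U.2 ?_)
  rw [← hPS]
  exact le_inf (h P (hPS ▸ inf_le_left)) (h S (hPS ▸ inf_le_right))

theorem PreservesIncidence.adj_iff {β : transversals E k ≃ transversals E k}
    {τ : transversals E (k + 1) ≃ transversals E (k + 1)} (h : PreservesIncidence β τ)
    (U W : transversals E k) :
    (transversalGraph E k).Adj (β U) (β W) ↔ (transversalGraph E k).Adj U W := by
  have adj_iff : ∀ A B : transversals E k, (transversalGraph E k).Adj A B ↔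
      A ≠ B ∧ ∃ T : transversals E (k + 1), A.1 ≤ T.1 ∧ B.1 ≤ T.1 := fun A B => by
    rw [Subtype.exists, ← Subtype.coe_injective.ne_iff]
    exact (sup_mem_transversals_iff A.2 B.2).trans (by simp only [exists_prop])
  rw [adj_iff, adj_iff, β.injective.ne_iff, τ.surjective.exists]
  simp only [h _ _]

theorem exists_descent (hE : E ≠ ⊥) (hn : k + 3 + finrank F E ≤ finrank F V)
    (τ : transversalGraph E (k + 1) ≃g transversalGraph E (k + 1)) :
    ∃ β : transversalGraph E k ≃g transversalGraph E k, PreservesIncidence β τ := by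
  obtain ⟨β, hβ⟩ := exists_star_image hE hn τ
  obtain ⟨γ, hγ⟩ := exists_star_image hE hn τ.symm
  have left : Function.LeftInverse γ β := fun U => eq_of_star_le hE (by omega) fun T hT => by
    simpa only [RelIso.symm_apply_apply] using (hγ (β U) (τ T)).2 ((hβ U T).2 hT)
  have right : Function.RightInverse γ β := fun U => eq_of_star_le hE (by omega) fun T hT => by
    simpa only [RelIso.apply_symm_apply] using (hβ (γ U) (τ.symm T)).2 ((hγ U T).2 hT)
  exact ⟨⟨⟨β, γ, left, right⟩, PreservesIncidence.adj_iff (β := ⟨β, γ, left, right⟩)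
    (τ := τ.toEquiv) hβ _ _⟩, hβ⟩

end Star

/-! ### Reconstruction of a semilinear map -/

section Additive

variable {K V V' : Type*} [Field K] [AddCommGroup V] [Module K V] [AddCommGroup V']
  {H : Submodule K V} {a : V → V'}

theorem sub_eq_sub_of_notMem_sup (ha : ∀ x y, x ∉ H → y ∉ H ⊔ span K {x} → a (x + y) = a x + a y)
    {x z w : V} (hz : z ∉ H ⊔ span K {x}) (hw : w ∉ H ⊔ span K {x} ⊔ span K {z}) :
    a (x + z) - a z = a (x + w) - a w := by
  have hx : x ∈ H ⊔ span K {x} := mem_sup_right (mem_span_singleton_self x)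
  have hxz : x + z ∉ H := fun h => hz (((H ⊔ span K {x}).add_mem_iff_right hx).1 (mem_sup_left h))
  have hwxz : w ∉ H ⊔ span K {x + z} := fun h => hw (sup_le (le_sup_left.trans le_sup_left)
    ((span_singleton_le_iff_mem _ _).2
      (add_mem (mem_sup_left hx) (mem_sup_right (mem_span_singleton_self z)))) h)
  have hxwz : x + w ∉ H ⊔ span K {z} := fun h =>
    hw ((Submodule.add_mem_iff_right _ (mem_sup_left hx)).1
      (sup_le_sup_right (le_sup_left : H ≤ H ⊔ span K {x}) (span K {z}) h))
  rw [sub_eq_sub_iff_add_eq_add, ← ha _ _ hxz hwxz, add_comm (a (x + w)),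
    ← ha _ _ (fun h => hz (mem_sup_left h)) hxwz]
  congr 1
  abel

theorem exists_addMonoidHom_eqOn_compl [FiniteDimensional K V]
    (hH : finrank K H + 3 ≤ finrank K V)
    (ha : ∀ x y, x ∉ H → y ∉ H ⊔ span K {x} → a (x + y) = a x + a y) :
    ∃ G : V →+ V', ∀ x, x ∉ H → G x = a x := by
  have finrank_sup_lt (x z : V) :
      finrank K (H ⊔ span K {x} ⊔ span K {z} : Submodule K V) < finrank K V := by
    have := finrank_sup_span_singleton_le H x
    have := finrank_sup_span_singleton_le (H ⊔ span K {x}) z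
    omega
  have sub_eq_sub {x z w : V} (hz : z ∉ H ⊔ span K {x}) (hw : w ∉ H ⊔ span K {x}) :
      a (x + z) - a z = a (x + w) - a w := by
    obtain ⟨u, huz, huw⟩ := exists_notMem_and_notMem
      (ne_top_of_finrank_lt (finrank_sup_lt x z)) (ne_top_of_finrank_lt (finrank_sup_lt x w))
    rw [sub_eq_sub_of_notMem_sup ha hz huz, sub_eq_sub_of_notMem_sup ha hw huw]
  choose ζ hζ using fun x => exists_notMem_of_finrank_lt
    ((finrank_mono le_sup_left).trans_lt (finrank_sup_lt x x))
  -- Off `H` this is just `a x`; on `H` additivity of `a` says nothing about `a x` itself.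
  refine ⟨AddMonoidHom.mk' (fun x => a (x + ζ x) - a (ζ x)) fun x y => ?_, fun x hx => ?_⟩
  · obtain ⟨z, hz⟩ := exists_notMem_of_finrank_lt (finrank_sup_lt x y)
    have hx : x ∈ H ⊔ span K {x} ⊔ span K {y} :=
      mem_sup_left (mem_sup_right (mem_span_singleton_self x))
    have hy : y ∈ H ⊔ span K {x} ⊔ span K {y} := mem_sup_right (mem_span_singleton_self y)
    have notMem {t : V} (ht : t ∈ H ⊔ span K {x} ⊔ span K {y}) : z ∉ H ⊔ span K {t} := fun h =>
      hz (sup_le (le_sup_left.trans le_sup_left) ((span_singleton_le_iff_mem _ _).2 ht) h)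
    have hyz : y + z ∉ H ⊔ span K {x} := fun h =>
      hz ((Submodule.add_mem_iff_right _ hy).1 (mem_sup_left h))
    rw [sub_eq_sub (hζ (x + y)) (notMem (add_mem hx hy)), sub_eq_sub (hζ x) hyz,
      sub_eq_sub (hζ y) (notMem hy), sub_add_sub_cancel, add_assoc]
  · rw [AddMonoidHom.mk'_apply, ha x _ hx (hζ x), add_sub_cancel_right]

end Additive

section Semilinear

variable {K K' V V' : Type*} [Field K] [Field K'] [AddCommGroup V] [Module K V] [AddCommGroup V']
  [Module K' V'] [FiniteDimensional K V] {H : Submodule K V} {f G : V →+ V'}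

theorem exists_forall_eq_smul (hH : finrank K H + 2 ≤ finrank K V)
    (hG : ∀ x y, x ∉ H → y ∉ H ⊔ span K {x} → LinearIndependent K' ![G x, G y])
    (hf : ∀ x, x ∉ H → f x ∈ span K' {G x}) : ∃ s : K', ∀ x, f x = s • G x := by
  obtain ⟨x, hx⟩ := exists_notMem_of_finrank_lt (H := H) (by omega)
  obtain ⟨s, hs⟩ := mem_span_singleton.1 (hf x hx)
  have hxH : x ∈ H ⊔ span K {x} := mem_sup_right (mem_span_singleton_self x)
  have off : ∀ y, y ∉ H ⊔ span K {x} → f y = s • G y := by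
    intro y hy
    obtain ⟨t, ht⟩ := mem_span_singleton.1 (hf y fun h => hy (mem_sup_left h))
    obtain ⟨r, hr⟩ := mem_span_singleton.1 (hf (x + y) fun h =>
      hy ((Submodule.add_mem_iff_right _ hxH).1 (mem_sup_left h)))
    rw [map_add, map_add] at hr
    obtain ⟨hrs, hrt⟩ := LinearIndependent.pair_iff.1 (hG x y hx hy) (r - s) (r - t)
      (by linear_combination (norm := module) hr - hs - ht)
    rw [← ht, ← sub_eq_zero.1 hrt, sub_eq_zero.1 hrs]
  refine ⟨s, fun y => ?_⟩
  by_cases hy : y ∈ H ⊔ span K {x}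
  · obtain ⟨w, hw⟩ := exists_notMem_of_finrank_lt (H := H ⊔ span K {x}) (by
      have := finrank_sup_span_singleton_le H x
      omega)
    have hyw := off (y + w) fun h => hw ((Submodule.add_mem_iff_right _ hy).1 h)
    rwa [map_add, map_add, smul_add, off w hw, add_left_inj] at hyw
  · exact off y hy

theorem exists_semilinearMap_of_smul_mem_span (hH : finrank K H + 2 ≤ finrank K V)
    (hG : ∀ x y, x ∉ H → y ∉ H ⊔ span K {x} → LinearIndependent K' ![G x, G y])
    (hsmul : ∀ x, x ∉ H → ∀ c : K, G (c • x) ∈ span K' {G x}) :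
    ∃ (σ : K →+* K') (g : V →ₛₗ[σ] V'), ∀ x, g x = G x := by
  obtain ⟨x, hx⟩ := exists_notMem_of_finrank_lt (H := H) (by omega)
  obtain ⟨y, hy⟩ := exists_notMem_of_finrank_lt (H := H ⊔ span K {x}) (by
    have := finrank_sup_span_singleton_le H x
    omega)
  have hGx : G x ≠ 0 := (hG x y hx hy).ne_zero 0
  choose σ hσ using fun c : K => exists_forall_eq_smul
    (f := G.comp (DistribSMul.toAddMonoidHom V c)) hH hG fun x hx => hsmul x hx c
  have smul (c : K) (z : V) : G (c • z) = σ c • G z := hσ c z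
  have inj {s t : K'} (h : s • G x = t • G x) : s = t := smul_left_injective K' hGx h
  refine ⟨RingHom.mk' ⟨⟨σ, ?_⟩, fun c d => ?_⟩ fun c d => ?_,
    { toFun := G, map_add' := map_add G, map_smul' := smul }, fun _ => rfl⟩
  · exact inj (by rw [← smul, one_smul, one_smul])
  · exact inj (by rw [← smul, mul_smul, smul, smul, mul_smul])
  · refine inj (?_ : σ (c + d) • G x = (σ c + σ d) • G x)
    rw [← smul, add_smul, map_add, smul, smul, add_smul]

end Semilinear

section Collineation

variable {K K' V V' : Type*} [Field K] [Field K'] [AddCommGroup V] [Module K V] [AddCommGroup V']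
  [Module K' V']

theorem eq_add_of_mem_span {A B C D z : V} (hBCA : LinearIndependent K ![B, C, A]) (hz : z ≠ 0)
    (hzB : z ∈ span K {C + A, B}) (hzA : z ∈ span K {C + B, A}) (hzD : z ∈ span K {C + D})
    (hD : D ∈ span K {A, B}) : D = A + B := by
  obtain ⟨s, t, hst⟩ := mem_span_pair.1 hzB
  obtain ⟨s', t', hst'⟩ := mem_span_pair.1 hzA
  obtain ⟨r, rfl⟩ := mem_span_singleton.1 hzD
  obtain ⟨p, q, hpq⟩ := mem_span_pair.1 hD
  have coeff {α β γ : K} (h : α • A + β • B + γ • C = 0) : α = 0 ∧ β = 0 ∧ γ = 0 := by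
    have := Fintype.linearIndependent_iff.1 hBCA ![β, γ, α] (by
      rw [Fin.sum_univ_three, ← h]
      exact (add_rotate _ _ _).symm)
    exact ⟨this 2, this 0, this 1⟩
  obtain ⟨hA, hB, hC⟩ := coeff (α := s - t') (β := t - s') (γ := s - s')
    (by linear_combination (norm := module) hst - hst')
  obtain ⟨-, -, hC'⟩ := coeff (α := s - r * p) (β := t - r * q) (γ := s - r)
    (by linear_combination (norm := module) hst - r • hpq)
  obtain rfl : s = r := sub_eq_zero.1 hC'
  obtain rfl : t = s := by linear_combination hB - hC
  have hr : t ≠ 0 := by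
    rintro rfl
    exact hz (zero_smul K _)
  refine smul_right_injective V hr ?_
  linear_combination (norm := module) -hst

/-- A map of vectors outside `E` to vectors outside `E'` that induces an isomorphism between the
geometries of points not in `E`, `E'` and lines disjoint from `E`, `E'`. Its values on `E` are
arbitrary. -/
structure IsCollineationOff (E : Submodule K V) (E' : Submodule K' V') (a : V → V') : Prop where
  notMem {v} : v ∉ E → a v ∉ E'
  notMem_sup {v w} : v ∉ E → w ∉ E ⊔ span K {v} → a w ∉ E' ⊔ span K' {a v}
  mem_span_singleton_iff {v z} : v ∉ E → z ∉ E → (a z ∈ span K' {a v} ↔ z ∈ span K {v})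
  mem_span_pair_iff {v w z} : v ∉ E → w ∉ E ⊔ span K {v} → z ∉ E →
    (a z ∈ span K' {a v, a w} ↔ z ∈ span K {v, w})
  exists_mem_span {y} : y ∉ E' → ∃ x, x ∉ E ∧ a x ∈ span K' {y}

namespace IsCollineationOff

variable {E : Submodule K V} {E' : Submodule K' V'} {a b : V → V'} {v w x y z : V}

theorem congr (ha : IsCollineationOff E E' a)
    (hab : ∀ x, x ∉ E → span K' {b x} = span K' {a x}) : IsCollineationOff E E' b := by
  have notMem_of_notMem_sup {v w : V} (hw : w ∉ E ⊔ span K {v}) : w ∉ E := fun h =>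
    hw (mem_sup_left h)
  refine ⟨fun hv => ?_, fun hv hw => ?_, fun hv hz => ?_, fun hv hw hz => ?_, fun hy => ?_⟩
  · rw [← span_singleton_le_iff_mem, hab _ hv, span_singleton_le_iff_mem]
    exact ha.notMem hv
  · rw [hab _ hv, ← span_singleton_le_iff_mem, hab _ (notMem_of_notMem_sup hw),
      span_singleton_le_iff_mem]
    exact ha.notMem_sup hv hw
  · rw [hab _ hv, ← span_singleton_le_iff_mem, hab _ hz, span_singleton_le_iff_mem]
    exact ha.mem_span_singleton_iff hv hz
  · rw [span_insert, hab _ hv, hab _ (notMem_of_notMem_sup hw), ← span_insert,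
      ← span_singleton_le_iff_mem, hab _ hz, span_singleton_le_iff_mem]
    exact ha.mem_span_pair_iff hv hw hz
  · obtain ⟨x, hx, hxy⟩ := ha.exists_mem_span hy
    refine ⟨x, hx, ?_⟩
    rwa [← span_singleton_le_iff_mem, hab _ hx, span_singleton_le_iff_mem]

theorem ne_zero (ha : IsCollineationOff E E' a) (hv : v ∉ E) : a v ≠ 0 := fun h =>
  ha.notMem hv (h ▸ zero_mem _)

theorem linearIndependent_pair (ha : IsCollineationOff E E' a) (hv : v ∉ E)
    (hw : w ∉ E ⊔ span K {v}) : LinearIndependent K' ![a v, a w] :=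
  linearIndependent_pair_of_notMem_sup (ha.notMem hv) (ha.notMem_sup hv hw)

theorem exists_add_mem_span (ha : IsCollineationOff E E' a) (hv : v ∉ E)
    (hx : x ∉ E ⊔ span K {v}) : ∃ c : K', c ≠ 0 ∧ a (x + v) ∈ span K' {a v + c • a x} := by
  have hxE : x ∉ E := fun h => hx (mem_sup_left h)
  have hv' : v ∈ E ⊔ span K {v} := mem_sup_right (mem_span_singleton_self v)
  have hxv : x + v ∉ E := fun h =>
    hx ((Submodule.add_mem_iff_left _ hv').1 (mem_sup_left h))
  obtain ⟨s, t, hst⟩ := mem_span_pair.1 ((ha.mem_span_pair_iff hv hx hxv).2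
    (mem_span_pair.2 ⟨1, 1, by module⟩))
  have hs : s ≠ 0 := by
    rintro rfl
    have h : x + v ∈ span K {x} := (ha.mem_span_singleton_iff hxE hxv).1
      (mem_span_singleton.2 ⟨t, by rw [← hst]; module⟩)
    exact notMem_sup_span_symm hv hx (mem_sup_right
      ((Submodule.add_mem_iff_right _ (mem_span_singleton_self x)).1 h))
  have ht : t ≠ 0 := by
    rintro rfl
    have h : x + v ∈ span K {v} := (ha.mem_span_singleton_iff hv hxv).1
      (mem_span_singleton.2 ⟨s, by rw [← hst]; module⟩)
    exact hx (mem_sup_right ((Submodule.add_mem_iff_left _ (mem_span_singleton_self v)).1 h))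
  refine ⟨s⁻¹ * t, mul_ne_zero (inv_ne_zero hs) ht, mem_span_singleton.2 ⟨s, ?_⟩⟩
  rw [← hst, smul_add, smul_smul, mul_inv_cancel_left₀ hs]

theorem exists_normalized (ha : IsCollineationOff E E' a) (hv : v ∉ E) :
    ∃ b : V → V', (∀ x, span K' {b x} = span K' {a x}) ∧
      ∀ x, x ∉ E ⊔ span K {v} → b (x + v) ∈ span K' {b v + b x} := by
  have : ∀ x, ∃ c : K', c ≠ 0 ∧ (x ∈ E ⊔ span K {v} → c = 1) ∧
      (x ∉ E ⊔ span K {v} → a (x + v) ∈ span K' {a v + c • a x}) := by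
    intro x
    by_cases hx : x ∈ E ⊔ span K {v}
    · exact ⟨1, one_ne_zero, fun _ => rfl, fun h => absurd hx h⟩
    · obtain ⟨c, hc, hcx⟩ := ha.exists_add_mem_span hv hx
      exact ⟨c, hc, fun h => absurd h hx, fun _ => hcx⟩
  choose c hc hc1 hcx using this
  refine ⟨fun x => c x • a x, fun x => span_singleton_smul_eq (hc x).isUnit _, fun x hx => ?_⟩
  beta_reduce
  rw [hc1 v (mem_sup_right (mem_span_singleton_self v)), one_smul]
  exact smul_mem _ _ (hcx x hx)

theorem add_add_mem_span (ha : IsCollineationOff E E' a)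
    (hav : ∀ x, x ∉ E ⊔ span K {v} → a (x + v) ∈ span K' {a v + a x})
    (hx : x ∉ E ⊔ span K {v}) (hy : y ∉ E ⊔ span K {v} ⊔ span K {x}) :
    a (x + y + v) ∈ span K' {a v + a x, a y} := by
  have hv : v ∈ E ⊔ span K {v} := mem_sup_right (mem_span_singleton_self v)
  have hxx : x ∈ E ⊔ span K {v} ⊔ span K {x} := mem_sup_right (mem_span_singleton_self x)
  have hxv : x + v ∉ E := fun h => hx ((Submodule.add_mem_iff_left _ hv).1 (mem_sup_left h))
  have hyxv : y ∉ E ⊔ span K {x + v} := fun h => hy (sup_le (le_sup_left.trans le_sup_left)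
    ((span_singleton_le_iff_mem _ _).2 (add_mem hxx (mem_sup_left hv))) h)
  have hxyv : x + y + v ∉ E := fun h => hy ((Submodule.add_mem_iff_right _ hxx).1
    (mem_sup_left ((Submodule.add_mem_iff_left _ hv).1 (mem_sup_left h))))
  have hmem := (ha.mem_span_pair_iff hxv hyxv hxyv).2 (mem_span_pair.2 ⟨1, 1, by module⟩)
  rw [span_insert] at hmem ⊢
  exact sup_le_sup_right ((span_singleton_le_iff_mem _ _).2 (hav x hx)) _ hmem

theorem apply_add (ha : IsCollineationOff E E' a) (hv : v ∉ E)
    (hav : ∀ x, x ∉ E ⊔ span K {v} → a (x + v) ∈ span K' {a v + a x})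
    (hx : x ∉ E ⊔ span K {v}) (hy : y ∉ E ⊔ span K {v} ⊔ span K {x}) : a (x + y) = a x + a y := by
  have hxE : x ∉ E := fun h => hx (mem_sup_left h)
  have hyH : y ∉ E ⊔ span K {v} := fun h => hy (mem_sup_left h)
  have hyx : y ∉ E ⊔ span K {x} := fun h =>
    hy (sup_le_sup_right (le_sup_left : E ≤ E ⊔ span K {v}) _ h)
  have hxyH : x + y ∉ E ⊔ span K {v} := fun h => hy ((Submodule.add_mem_iff_right _
    (mem_sup_right (mem_span_singleton_self x))).1 (mem_sup_left h))
  have hxyv : x + y + v ∉ E := fun h => hxyH ((Submodule.add_mem_iff_left _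
    (mem_sup_right (mem_span_singleton_self v))).1 (mem_sup_left h))
  have hyvx : a y ∉ span K' {a v, a x} := fun h => by
    rw [ha.mem_span_pair_iff hv hx fun h => hyH (mem_sup_left h), span_insert] at h
    exact hy (sup_le_sup_right (le_sup_right : span K {v} ≤ E ⊔ span K {v}) _ h)
  refine eq_add_of_mem_span (z := a (x + y + v)) (C := a v)
    (linearIndependent_finCons.2 ⟨ha.linearIndependent_pair hv hx, ?_⟩) (ha.ne_zero hxyv)
    (ha.add_add_mem_span hav hx hy) ?_ (hav _ hxyH)
    ((ha.mem_span_pair_iff hxE hyx fun h => hxyH (mem_sup_left h)).2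
      (mem_span_pair.2 ⟨1, 1, by module⟩))
  · rwa [Matrix.range_cons_cons_empty]
  · rw [add_comm x y]
    exact ha.add_add_mem_span hav hyH (notMem_sup_span_symm hx hy)

section Reconstruction

variable {H : Submodule K V} {σ : K →+* K'} {g : V →ₛₗ[σ] V'}

theorem injective_of_eqOn_compl (ha : IsCollineationOff E E' a) (hEH : E ≤ H) (hH : H ≠ ⊤)
    (hg : ∀ x, x ∉ H → g x = a x) : Function.Injective g := by
  rw [injective_iff_map_eq_zero]
  intro u hu
  have huH : u ∈ H := by_contra fun h => ha.ne_zero (fun hE => h (hEH hE)) (hg u h ▸ hu)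
  obtain ⟨x, hx⟩ := SetLike.exists_not_mem_of_ne_top H hH
  have hxu : x + u ∉ H := fun h => hx ((Submodule.add_mem_iff_left _ huH).1 h)
  have hspan : x + u ∈ span K {x} := by
    rw [← ha.mem_span_singleton_iff (fun h => hx (hEH h)) fun h => hxu (hEH h), ← hg x hx,
      ← hg _ hxu, map_add, hu, add_zero]
    exact mem_span_singleton_self _
  exact disjoint_def.1 (disjoint_span_singleton_of_notMem hx) u huH
    ((Submodule.add_mem_iff_right _ (mem_span_singleton_self x)).1 hspan)

theorem exists_apply_eq [RingHomSurjective σ] (ha : IsCollineationOff E E' a) (hEH : E ≤ H)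
    (hg : ∀ x, x ∉ H → g x = a x) {z : V} (hzH : z ∈ H) (hz : z ∉ E) (hy : y ∉ H) :
    ∃ w ∈ span K {z} ⊔ span K {y}, g w = a z := by
  have hyz : z + y ∉ H := fun h => hy ((Submodule.add_mem_iff_right _ hzH).1 h)
  have hzy : z + y ∉ E ⊔ span K {y} := fun h => notMem_sup_span_symm hz
    (fun h => hy (sup_le hEH ((span_singleton_le_iff_mem _ _).2 hzH) h))
    ((Submodule.add_mem_iff_left _ (mem_sup_right (mem_span_singleton_self y))).1 h)
  have haz : a z ∈ span K' {a y, a (z + y)} :=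
    (ha.mem_span_pair_iff (fun h => hy (hEH h)) hzy hz).2 (mem_span_pair.2 ⟨-1, 1, by module⟩)
  rw [← hg y hy, ← hg _ hyz, ← Set.image_pair, ← map_span] at haz
  obtain ⟨w, hw, hwz⟩ := haz
  refine ⟨w, span_le.2 ?_ hw, hwz⟩
  rintro _ (rfl | rfl)
  · exact mem_sup_right (mem_span_singleton_self _)
  · exact add_mem_sup (mem_span_singleton_self _) (mem_span_singleton_self _)

variable [FiniteDimensional K V]

theorem surjective_ringHom (ha : IsCollineationOff E E' a) (hEH : E ≤ H)
    (hH : finrank K H + 2 ≤ finrank K V) (hg : ∀ x, x ∉ H → g x = a x) :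
    Function.Surjective σ := by
  intro c
  obtain ⟨x, hx⟩ := exists_notMem_of_finrank_lt (H := H) (by omega)
  obtain ⟨y, hy⟩ := exists_notMem_of_finrank_lt (H := H ⊔ span K {x}) (by
    have := finrank_sup_span_singleton_le H x
    omega)
  have hyH : y ∉ H := fun h => hy (mem_sup_left h)
  have hxE : x ∉ E := fun h => hx (hEH h)
  have hyE : y ∉ E ⊔ span K {x} := fun h => hy (sup_le_sup_right hEH _ h)
  rcases eq_or_ne c 0 with rfl | hc
  · exact ⟨0, map_zero σ⟩
  have hxy : a x + c • a y ∉ E' := fun h => ha.notMem_sup hxE hyE ((smul_mem_iff _ hc).1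
    ((Submodule.add_mem_iff_right _ (mem_sup_right (mem_span_singleton_self _))).1
      (mem_sup_left h)))
  obtain ⟨z, hz, haz⟩ := ha.exists_mem_span hxy
  obtain ⟨μ, hμ⟩ := mem_span_singleton.1 haz
  have hμ0 : μ ≠ 0 := by
    rintro rfl
    exact ha.ne_zero hz (hμ.symm.trans (zero_smul K' _))
  have hzxy : z ∈ span K {x, y} := by
    rw [← ha.mem_span_pair_iff hxE hyE hz]
    exact (span_singleton_le_iff_mem _ _).2 (mem_span_pair.2 ⟨1, c, by rw [one_smul]⟩) haz
  have hzH : z ∉ H := fun h => by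
    have hzx := inf_sup_span_singleton_le hy ⟨h, (span_insert x {y}).le hzxy⟩
    exact hz (disjoint_def.1 (disjoint_span_singleton_of_notMem hx) z h hzx ▸ zero_mem E)
  obtain ⟨s, t, rfl⟩ := mem_span_pair.1 hzxy
  rw [← hg _ hzH, map_add, map_smulₛₗ, map_smulₛₗ, hg x hx, hg y hyH] at hμ
  obtain ⟨hs, ht⟩ := LinearIndependent.pair_iff.1 (ha.linearIndependent_pair hxE hyE) (σ s - μ)
    (σ t - μ * c) (by linear_combination (norm := module) -hμ)
  exact ⟨t / s, by
    rw [map_div₀, sub_eq_zero.1 hs, sub_eq_zero.1 ht, mul_div_cancel_left₀ _ hμ0]⟩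

theorem mem_span_apply [RingHomSurjective σ] (ha : IsCollineationOff E E' a) (hEH : E ≤ H)
    (hH : finrank K H + 2 ≤ finrank K V) (hg : ∀ x, x ∉ H → g x = a x) {z : V} (hz : z ∉ E) :
    a z ∈ span K' {g z} := by
  by_cases hzH : z ∈ H
  · obtain ⟨x, hx⟩ := exists_notMem_of_finrank_lt (H := H) (by omega)
    obtain ⟨y, hy⟩ := exists_notMem_of_finrank_lt (H := H ⊔ span K {x}) (by
      have := finrank_sup_span_singleton_le H x
      omega)
    have hz' := (span_singleton_le_iff_mem _ _).2 hzH
    obtain ⟨w, hw, hwz⟩ := ha.exists_apply_eq hEH hg hzH hz hx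
    obtain ⟨w', hw', hwz'⟩ := ha.exists_apply_eq hEH hg hzH hz fun h => hy (mem_sup_left h)
    obtain rfl := ha.injective_of_eqOn_compl hEH (ne_top_of_finrank_lt (by omega)) hg
      (hwz.trans hwz'.symm)
    have hyx : y ∉ span K {z} ⊔ span K {x} ⊔ span K {z} := fun h =>
      hy (sup_le (sup_le_sup_right hz' _) (hz'.trans le_sup_left) h)
    obtain ⟨c, rfl⟩ := mem_span_singleton.1 (inf_sup_span_singleton_le hyx ⟨hw, hw'⟩)
    rw [← hwz, map_smulₛₗ]
    exact smul_mem _ _ (mem_span_singleton_self _)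
  · rw [hg z hzH]
    exact mem_span_singleton_self _

theorem surjective_of_eqOn_compl [RingHomSurjective σ] (ha : IsCollineationOff E E' a)
    (hEH : E ≤ H) (hH : finrank K H + 2 ≤ finrank K V) (hg : ∀ x, x ∉ H → g x = a x) :
    Function.Surjective g := by
  obtain ⟨v, hv⟩ := exists_notMem_of_finrank_lt (H := H) (by omega)
  rw [← LinearMap.range_eq_top]
  by_contra hrange
  obtain ⟨y, hy, hyE⟩ := exists_notMem_and_notMem hrange
    (fun h : E' = ⊤ => ha.notMem (fun h => hv (hEH h)) (h ▸ mem_top : a v ∈ E'))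
  obtain ⟨x, hx, hxy⟩ := ha.exists_mem_span hyE
  obtain ⟨c, hc⟩ := mem_span_singleton.1 hxy
  have hc0 : c ≠ 0 := by
    rintro rfl
    exact ha.ne_zero hx (hc.symm.trans (zero_smul K' y))
  refine hy ((smul_mem_iff _ hc0).1 (hc ▸ ?_))
  exact (span_singleton_le_iff_mem _ _).2 (LinearMap.mem_range_self g x)
    (ha.mem_span_apply hEH hH hg hx)

theorem exists_semilinearMap_eqOn_compl (ha : IsCollineationOff E E' a)
    (hE : finrank K E + 4 ≤ finrank K V) (hv : v ∉ E)
    (hav : ∀ x, x ∉ E ⊔ span K {v} → a (x + v) ∈ span K' {a v + a x}) :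
    ∃ (σ : K →+* K') (g : V →ₛₗ[σ] V'), ∀ x, x ∉ E ⊔ span K {v} → g x = a x := by
  have hH := finrank_sup_span_singleton_le E v
  obtain ⟨G, hG⟩ := exists_addMonoidHom_eqOn_compl (by omega) fun x y => ha.apply_add hv hav
  obtain ⟨σ, g, hg⟩ := exists_semilinearMap_of_smul_mem_span (K' := K') (H := E ⊔ span K {v})
    (G := G) (by omega)
    (fun x y hx hy => by
      rw [hG x hx, hG y fun h => hy (mem_sup_left h)]
      exact ha.linearIndependent_pair (fun h => hx (mem_sup_left h)) fun h =>
        hy (sup_le_sup_right (le_sup_left : E ≤ E ⊔ span K {v}) _ h))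
    (fun x hx c => by
      rcases eq_or_ne c 0 with rfl | hc
      · rw [zero_smul, map_zero]
        exact zero_mem _
      · have hcx : c • x ∉ E ⊔ span K {v} := fun h => hx ((smul_mem_iff _ hc).1 h)
        rw [hG _ hcx, hG x hx, ha.mem_span_singleton_iff (fun h => hx (mem_sup_left h))
          fun h => hcx (mem_sup_left h)]
        exact smul_mem _ _ (mem_span_singleton_self x))
  exact ⟨σ, g, fun x hx => (hg x).trans (hG x hx)⟩

theorem exists_bijective_semilinearMap (ha : IsCollineationOff E E' a)
    (hE : finrank K E + 4 ≤ finrank K V) :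
    ∃ (σ : K →+* K') (g : V →ₛₗ[σ] V'), Function.Bijective σ ∧ Function.Bijective g ∧
      ∀ x, x ∉ E → span K' {a x} = span K' {g x} := by
  obtain ⟨v, hv⟩ := exists_notMem_of_finrank_lt (H := E) (by omega)
  have hEH : E ≤ E ⊔ span K {v} := le_sup_left
  have hH : finrank K (E ⊔ span K {v} : Submodule K V) + 2 ≤ finrank K V := by
    have := finrank_sup_span_singleton_le E v
    omega
  obtain ⟨b, hba, hbv⟩ := ha.exists_normalized hv
  have hb : IsCollineationOff E E' b := ha.congr fun x _ => hba x
  obtain ⟨σ, g, hg⟩ := hb.exists_semilinearMap_eqOn_compl hE hv hbv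
  have hσ : Function.Surjective σ := hb.surjective_ringHom hEH hH hg
  have : RingHomSurjective σ := ⟨hσ⟩
  have hginj : Function.Injective g :=
    hb.injective_of_eqOn_compl hEH (ne_top_of_finrank_lt (by omega)) hg
  refine ⟨σ, g, ⟨σ.injective, hσ⟩, ⟨hginj, hb.surjective_of_eqOn_compl hEH hH hg⟩, fun x hx => ?_⟩
  obtain ⟨c, hc⟩ := mem_span_singleton.1 (hb.mem_span_apply hEH hH hg hx)
  have hc0 : c ≠ 0 := by
    rintro rfl
    exact hb.ne_zero hx (hc.symm.trans (zero_smul K' _))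
  rw [← hba x, ← hc, span_singleton_smul_eq hc0.isUnit]

end Reconstruction

end IsCollineationOff

end Collineation

/-! ### The action of semilinear bijections on transversals -/

section Action

variable {F V : Type*} [Field F] [AddCommGroup V] [Module F V] {E P Q : Submodule F V} {k m : ℕ}

namespace GammaL

theorem smul_inf (g : GammaL F V) (P Q : Submodule F V) : g • (P ⊓ Q) = g • P ⊓ g • Q :=
  SetLike.coe_injective (Set.image_inter (g : Equiv.Perm V).injective)

theorem smul_le_smul_iff (g : GammaL F V) : g • P ≤ g • Q ↔ P ≤ Q :=
  Set.image_subset_image_iff (g : Equiv.Perm V).injective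

/-- The lattice automorphism induced by `g`. -/
def submoduleOrderIso (g : GammaL F V) : Submodule F V ≃o Submodule F V where
  toEquiv := MulAction.toPerm g
  map_rel_iff' := smul_le_smul_iff g

theorem smul_sup (g : GammaL F V) (P Q : Submodule F V) : g • (P ⊔ Q) = g • P ⊔ g • Q :=
  (submoduleOrderIso g).map_sup P Q

theorem finrank_smul (g : GammaL F V) (P : Submodule F V) :
    finrank F (g • P : Submodule F V) = finrank F P := by
  obtain ⟨σ, hσ⟩ := g.2.2
  let e : P ≃+ (g • P : Submodule F V) :=
    AddEquiv.mk' ((g : Equiv.Perm V).image P) fun x y => Subtype.ext (g.2.1 x y)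
  exact (congrArg Cardinal.toNat
    (rank_eq_of_equiv_equiv σ e σ.bijective fun c x => Subtype.ext (hσ c x))).symm

theorem smul_mem_transversals_iff {g : GammaL F V} (hg : g • E = E) :
    g • P ∈ transversals E m ↔ P ∈ transversals E m := by
  refine and_congr (by rw [finrank_smul]) ?_
  nth_rw 1 [← hg]
  exact disjoint_map_orderIso_iff (submoduleOrderIso g)

theorem smul_span_singleton (g : GammaL F V) (v : V) :
    g • span F {v} = span F {(g : Equiv.Perm V) v} := by
  obtain ⟨g, hg, σ, hσ⟩ := g
  apply le_antisymm
  · rintro _ ⟨x, hx, rfl⟩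
    obtain ⟨c, rfl⟩ := mem_span_singleton.1 hx
    exact mem_span_singleton.2 ⟨σ c, (hσ c v).symm⟩
  · rw [span_singleton_le_iff_mem]
    exact ⟨v, mem_span_singleton_self v, rfl⟩

variable [FiniteDimensional F V]

theorem mem_scalarSubgroup_of_forall_notMem {g : GammaL F V}
    (hE : finrank F E + 2 ≤ finrank F V) (h : ∀ v, v ∉ E → g • span F {v} = span F {v}) :
    g ∈ scalarSubgroup F V := by
  obtain ⟨c, hc⟩ := exists_forall_eq_smul (K' := F) (H := E) (G := AddMonoidHom.id V)
    (f := AddMonoidHom.mk' (g : Equiv.Perm V) g.2.1) hE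
    (fun x y => linearIndependent_pair_of_notMem_sup) (fun v hv => by
      rw [AddMonoidHom.id_apply, ← h v hv, smul_span_singleton]
      exact mem_span_singleton_self _)
  have hc0 : c ≠ 0 := by
    rintro rfl
    obtain ⟨v, hv⟩ := exists_notMem_of_finrank_lt (H := E) (by omega)
    have hvbot := h v hv
    rw [smul_span_singleton] at hvbot
    have : (g : Equiv.Perm V) v = 0 := (hc v).trans (zero_smul F v)
    rw [this, span_zero_singleton, eq_comm, span_singleton_eq_bot] at hvbot
    exact hv (hvbot ▸ zero_mem E)
  exact ⟨Units.mk0 c hc0, hc⟩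

theorem mem_scalarSubgroup_of_forall_transversals (hE : E ≠ ⊥) {g : GammaL F V} (hm : 1 ≤ m)
    (hn : m + finrank F E ≤ finrank F V) (hn' : finrank F E + 2 ≤ finrank F V)
    (h : ∀ P ∈ transversals E m, g • P = P) : g ∈ scalarSubgroup F V := by
  induction m, hm using Nat.le_induction with
  | base =>
    exact mem_scalarSubgroup_of_forall_notMem hn' fun v hv =>
      h _ (span_singleton_mem_transversals hv)
  | succ k _ ih =>
    refine ih (by omega) fun U hU => ?_
    obtain ⟨P, S, -, -, rfl : P.1 ⊓ S.1 = U⟩ := exists_inf_eq hE (by omega) ⟨U, hU⟩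
    rw [smul_inf, h P P.2, h S S.2]

end GammaL

end Action

/-! ### Automorphisms of the graph of transversals -/

section Automorphism

variable {F V : Type*} [Field F] [AddCommGroup V] [Module F V] {E : Submodule F V} {k m : ℕ}

/-- The bijective semilinear map `f` as an element of `ΓL(V)`. -/
noncomputable def GammaL.ofBijective {σ : F →+* F} (hσ : Function.Bijective σ) (f : V →ₛₗ[σ] V)
    (hf : Function.Bijective f) : GammaL F V :=
  ⟨Equiv.ofBijective f hf, map_add f, RingEquiv.ofBijective σ hσ, map_smulₛₗ f⟩

theorem PGammaL.smul_sup (g : PGammaL F V) (P Q : Submodule F V) :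
    g • (P ⊔ Q) = g • P ⊔ g • Q := by
  obtain ⟨g, rfl⟩ := QuotientGroup.mk'_surjective (scalarSubgroup F V) g
  exact GammaL.smul_sup g P Q

theorem PGammaL.smul_mem_transversals_iff {g : PGammaL F V} (hg : g • E = E) {P : Submodule F V} :
    g • P ∈ transversals E m ↔ P ∈ transversals E m := by
  obtain ⟨g, rfl⟩ := QuotientGroup.mk'_surjective (scalarSubgroup F V) g
  exact GammaL.smul_mem_transversals_iff hg

variable [FiniteDimensional F V]

theorem GammaL.smul_eq_of_forall_notMem {g : GammaL F V}
    (h : ∀ v, v ∉ E → (g : Equiv.Perm V) v ∉ E) : g • E = E := by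
  refine (eq_of_le_of_finrank_eq (fun x hx => ?_) (finrank_smul g E).symm).symm
  obtain ⟨y, rfl⟩ := (g : Equiv.Perm V).surjective x
  exact ⟨y, by_contra fun hy => h y hy hx, rfl⟩

theorem PreservesIncidence.sup_eq {β : transversalGraph E k ≃g transversalGraph E k}
    {τ : transversals E (k + 1) → transversals E (k + 1)} (h : PreservesIncidence β τ)
    {P Q : transversals E k} (hPQ : P.1 ⊔ Q.1 ∈ transversals E (k + 1)) :
    (β P).1 ⊔ (β Q).1 = (τ ⟨_, hPQ⟩).1 :=
  eq_of_le_of_mem_transversals (β.map_adj_iff.2 hPQ) (τ _).2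
    (sup_le ((h _ _).2 le_sup_left) ((h _ _).2 le_sup_right))

theorem PreservesIncidence.isCollineationOff {β : transversalGraph E 1 ≃g transversalGraph E 1}
    {τ : transversals E (1 + 1) → transversals E (1 + 1)} (h : PreservesIncidence β τ) {a : V → V}
    (haE : ∀ v, v ∉ E → a v ∉ E) (ha : ∀ v (hv : v ∉ E), β (point v hv) = point (a v) (haE v hv)) :
    IsCollineationOff E E a := by
  have span_apply (v : V) (hv : v ∉ E) : span F {a v} = (β (point v hv)).1 :=
    congrArg Subtype.val (ha v hv).symm
  have notMem_of_notMem_sup {v w : V} (hw : w ∉ E ⊔ span F {v}) : w ∉ E := fun h =>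
    hw (mem_sup_left h)
  refine ⟨fun hv => haE _ hv, fun {v w} hv hw => ?_, fun {v z} hv hz => ?_,
    fun {v w z} hv hw hz => ?_, fun {y} hy => ?_⟩
  · rw [← span_singleton_sup_mem_transversals_iff (haE v hv), span_apply v hv,
      span_apply w (notMem_of_notMem_sup hw)]
    exact β.map_adj_iff.2 ((span_singleton_sup_mem_transversals_iff hv).2 hw)
  · rw [← span_singleton_le_iff_mem, ← span_singleton_le_iff_mem, span_apply v hv, span_apply z hz]
    refine ⟨fun hle => ?_, fun hle => ?_⟩
    · have := β.injective (Subtype.ext (eq_of_le_of_mem_transversals (β _).2 (β _).2 hle))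
      exact (congrArg Subtype.val this).le
    · have : point z hz = point v hv :=
        Subtype.ext (eq_of_le_of_mem_transversals (point z hz).2 (point v hv).2 hle)
      rw [this]
  · have hwE := notMem_of_notMem_sup hw
    have hL : (point v hv).1 ⊔ (point w hwE).1 ∈ transversals E 2 :=
      (span_singleton_sup_mem_transversals_iff hv).2 hw
    rw [span_insert, span_insert, span_apply v hv, span_apply w hwE, h.sup_eq hL,
      ← span_singleton_le_iff_mem, ← span_singleton_le_iff_mem, span_apply z hz]
    exact h (point z hz) ⟨_, hL⟩
  · obtain ⟨p, hp⟩ := β.surjective (point y hy)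
    obtain ⟨x, hx, rfl⟩ := exists_eq_point p
    refine ⟨x, hx, ?_⟩
    rw [← span_singleton_le_iff_mem, span_apply x hx, hp]
    exact le_rfl

theorem exists_gammaL_of_points_lines (hE : finrank F E + 4 ≤ finrank F V)
    {β : transversalGraph E 1 ≃g transversalGraph E 1}
    {τ : transversals E (1 + 1) → transversals E (1 + 1)} (h : PreservesIncidence β τ) :
    ∃ g : GammaL F V, g • E = E ∧ ∀ p, (β p).1 = g • p.1 := by
  have : ∀ v, ∃ x, ∀ hv : v ∉ E, ∃ hx : x ∉ E, β (point v hv) = point x hx := fun v => by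
    by_cases hv : v ∈ E
    · exact ⟨0, fun h => absurd hv h⟩
    · exact (exists_eq_point (β (point v hv))).imp fun _ h _ => h
  choose a haE ha using this
  obtain ⟨σ, f, hσ, hf, haf⟩ := (h.isCollineationOff haE ha).exists_bijective_semilinearMap hE
  let g : GammaL F V := GammaL.ofBijective hσ f hf
  refine ⟨g, GammaL.smul_eq_of_forall_notMem fun v hv hfv => haE v hv ?_, fun p => ?_⟩
  · rw [← span_singleton_le_iff_mem, haf v hv]
    exact (span_singleton_le_iff_mem _ _).2 hfv
  · obtain ⟨v, hv, rfl⟩ := exists_eq_point p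
    rw [ha v hv]
    exact (haf v hv).trans (GammaL.smul_span_singleton g v).symm

theorem PreservesIncidence.eq_smul (hk : 1 ≤ k) {β : transversals E k → transversals E k}
    {τ : transversals E (k + 1) → transversals E (k + 1)} (h : PreservesIncidence β τ)
    {g : GammaL F V} (hg : g • E = E) (hβ : ∀ U, (β U).1 = g • U.1)
    (T : transversals E (k + 1)) : (τ T).1 = g • T.1 := by
  refine (eq_of_le_of_mem_transversals ((GammaL.smul_mem_transversals_iff hg).2 T.2) (τ T).2
    ?_).symm
  rintro _ ⟨x, hx, rfl⟩
  obtain ⟨U, hxU, hUT, hU⟩ := exists_le_le_finrank_eq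
    ((span_singleton_le_iff_mem x T.1).2 hx) ((finrank_span_le_card {x}).trans (by simpa using hk))
    (k.le_succ.trans_eq T.2.1.symm)
  have hle := (h ⟨U, transversals_of_le T.2 hUT hU⟩ T).2 hUT
  rw [hβ] at hle
  exact hle ⟨x, (span_singleton_le_iff_mem _ _).1 hxU, rfl⟩

theorem exists_gammaL_eq_smul (hE : E ≠ ⊥) (hm : 2 ≤ m) (hn : m + 2 + finrank F E ≤ finrank F V)
    (τ : transversalGraph E m ≃g transversalGraph E m) :
    ∃ g : GammaL F V, g • E = E ∧ ∀ P, (τ P).1 = g • P.1 := by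
  induction m, hm using Nat.le_induction with
  | base =>
    obtain ⟨β, hβ⟩ := exists_descent hE (by omega) τ
    obtain ⟨g, hg, h⟩ := exists_gammaL_of_points_lines (by omega) hβ
    exact ⟨g, hg, hβ.eq_smul le_rfl hg h⟩
  | succ k hk ih =>
    obtain ⟨β, hβ⟩ := exists_descent hE (by omega) τ
    obtain ⟨g, hg, h⟩ := ih (by omega) β
    exact ⟨g, hg, hβ.eq_smul (by omega) hg h⟩

/-- The action of `PΓL(V)_E` on the graph of transversals of `E`. -/
def stabilizerToAut (E : Submodule F V) (m : ℕ) :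
    MulAction.stabilizer (PGammaL F V) E →* (transversalGraph E m ≃g transversalGraph E m) where
  toFun g :=
    { toEquiv := (MulAction.toPerm g.1).subtypeEquiv fun _ =>
        (PGammaL.smul_mem_transversals_iff g.2).symm
      map_rel_iff' {P Q} := by
        change g.1 • P.1 ⊔ g.1 • Q.1 ∈ _ ↔ _
        rw [← PGammaL.smul_sup]
        exact PGammaL.smul_mem_transversals_iff g.2 }
  map_one' := RelIso.ext fun P => Subtype.ext (one_smul (PGammaL F V) P.1)
  map_mul' g h := RelIso.ext fun P => Subtype.ext (mul_smul g.1 h.1 P.1)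

theorem stabilizerToAut_injective (hE : E ≠ ⊥) (hm : 1 ≤ m) (hn : m + finrank F E ≤ finrank F V)
    (hn' : finrank F E + 2 ≤ finrank F V) : Function.Injective (stabilizerToAut E m) := by
  rw [injective_iff_map_eq_one]
  rintro ⟨g, hg⟩ h
  obtain ⟨g, rfl⟩ := QuotientGroup.mk'_surjective (scalarSubgroup F V) g
  exact Subtype.ext ((QuotientGroup.eq_one_iff g).2
    (GammaL.mem_scalarSubgroup_of_forall_transversals hE hm hn hn' fun P hP =>
      congrArg Subtype.val (DFunLike.congr_fun h (⟨P, hP⟩ : transversals E m))))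

theorem stabilizerToAut_surjective (hE : E ≠ ⊥) (hm : 2 ≤ m)
    (hn : m + 2 + finrank F E ≤ finrank F V) : Function.Surjective (stabilizerToAut E m) := by
  intro τ
  obtain ⟨g, hg, h⟩ := exists_gammaL_eq_smul hE hm hn τ
  exact ⟨⟨PGammaL.mk g, hg⟩, RelIso.ext fun P => Subtype.ext (h P).symm⟩

end Automorphism

/-! ### The graph of subspaces of type `(m, 0)` -/

section AttenuatedAut

variable {F : Type*} [Field F] {n l m : ℕ}

theorem finrank_subspaceE : finrank F (subspaceE F n l) = l := by
  have h : LinearIndependent F fun i : Fin l =>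
      (Pi.single (Fin.natAdd n i) 1 : Fin (n + l) → F) :=
    (Pi.linearIndependent_single_one (Fin (n + l)) F).comp _ (Fin.natAdd_injective l n)
  rw [subspaceE, finrank_span_eq_card h, Fintype.card_fin]

theorem ker_funLeft_castAdd :
    LinearMap.ker (LinearMap.funLeft F F (Fin.castAdd (n := n) l)) = subspaceE F n l := by
  have hle : subspaceE F n l ≤ LinearMap.ker (LinearMap.funLeft F F (Fin.castAdd l)) := by
    rw [subspaceE, span_le]
    rintro _ ⟨i, rfl⟩
    refine funext fun j => Pi.single_eq_of_ne (Fin.ne_of_lt ?_) 1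
    exact j.isLt.trans_le (Nat.le_add_right n i)
  have h := LinearMap.finrank_range_add_finrank_ker
    (LinearMap.funLeft F F (Fin.castAdd (n := n) l))
  rw [LinearMap.range_eq_top.2
    (LinearMap.funLeft_surjective_of_injective F F _ (Fin.castAdd_injective n l)),
    finrank_top, finrank_fin_fun, finrank_fin_fun] at h
  exact (eq_of_le_of_finrank_eq hle (finrank_subspaceE.trans (by omega))).symm

theorem subspaceE_ne_bot (hl : 0 < l) : subspaceE F n l ≠ ⊥ := by
  rw [← one_le_finrank_iff, finrank_subspaceE]
  exact hl

theorem finrank_map_add_finrank_inf_ker {V W : Type*} [AddCommGroup V] [Module F V]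
    [AddCommGroup W] [Module F W] [FiniteDimensional F V] (f : V →ₗ[F] W) (P : Submodule F V) :
    finrank F (P.map f) + finrank F (P ⊓ LinearMap.ker f : Submodule F V) = finrank F P := by
  have h := LinearMap.finrank_range_add_finrank_ker (f.domRestrict P)
  rwa [LinearMap.range_domRestrict, LinearMap.ker_domRestrict,
    ← finrank_map_subtype_eq, map_comap_subtype] at h

theorem finrank_firstPart (P : Submodule F (Fin (n + l) → F)) :
    finrank F (firstPart P) + finrank F (P ⊓ subspaceE F n l : Submodule F (Fin (n + l) → F)) =
      finrank F P := by
  rw [← ker_funLeft_castAdd]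
  exact finrank_map_add_finrank_inf_ker _ P

theorem attX_eq_transversals : attX F n l m = transversals (subspaceE F n l) m :=
  Set.ext fun P => and_congr_right' (by rw [finrank_eq_zero, disjoint_iff])

theorem attGraph_adj_iff (P Q : attX F n l m) :
    (attGraph F n l m).Adj P Q ↔ P.1 ⊔ Q.1 ∈ transversals (subspaceE F n l) (m + 1) := by
  have hP := finrank_firstPart P.1
  have hQ := finrank_firstPart Q.1
  have hPQ := finrank_firstPart (P.1 ⊔ Q.1)
  have hsup := finrank_sup_add_finrank_inf_eq P.1 Q.1
  have hsup' := finrank_sup_add_finrank_inf_eq (firstPart P.1) (firstPart Q.1)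
  have hmap : firstPart (P.1 ⊔ Q.1) = firstPart P.1 ⊔ firstPart Q.1 := Submodule.map_sup _ _ _
  rw [hmap] at hPQ
  rw [P.2.2, P.2.1] at hP
  rw [Q.2.2, Q.2.1] at hQ
  rw [P.2.1, Q.2.1] at hsup
  change _ ∧ _ ↔ _ ∧ _
  rw [disjoint_iff, ← finrank_eq_zero (R := F)]
  omega

/-- The graph `Γ^(m)` as the graph of transversals of `E`, with the identity on vertices. -/
def attGraphIso : attGraph F n l m ≃g transversalGraph (subspaceE F n l) m where
  toEquiv := Equiv.setCongr attX_eq_transversals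
  map_rel_iff' {P Q} := (attGraph_adj_iff P Q).symm

end AttenuatedAut

/-- Conjugation by an isomorphism of relations, as an isomorphism of automorphism groups. -/
def relIsoAutCongr {α β : Type*} {r : α → α → Prop} {s : β → β → Prop} (e : r ≃r s) :
    (r ≃r r) ≃* (s ≃r s) where
  toFun f := (e.symm.trans f).trans e
  invFun f := (e.trans f).trans e.symm
  left_inv f := RelIso.ext fun x => by simp
  right_inv f := RelIso.ext fun x => by simp
  map_mul' f g := RelIso.ext fun x => by simp

theorem lemma2p6_general (F : Type*) [Field F] (n l m : ℕ)
    (hm : 1 < m) (hmn : m + 1 < n) (hl : 0 < l) :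
    ∃ φ : PGammaLStabE F n l ≃* (attGraph F n l m ≃g attGraph F n l m),
      ∀ (g : PGammaLStabE F n l) (P : attX F n l m),
        (φ g P : Submodule F (Fin (n + l) → F)) =
          (g : PGammaL F (Fin (n + l) → F)) • (P : Submodule F (Fin (n + l) → F)) := by
  have hE := finrank_subspaceE (F := F) (n := n) (l := l)
  have hV : finrank F (Fin (n + l) → F) = n + l := finrank_fin_fun F
  have hbij : Function.Bijective (stabilizerToAut (subspaceE F n l) m) :=
    ⟨stabilizerToAut_injective (subspaceE_ne_bot hl) hm.le (by omega) (by omega),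
      stabilizerToAut_surjective (subspaceE_ne_bot hl) hm (by omega)⟩
  exact ⟨(MulEquiv.ofBijective _ hbij).trans (relIsoAutCongr attGraphIso.symm), fun _ _ => rfl⟩

theorem lemma2p6 (F : Type*) [Field F] [Finite F] (n l m : ℕ)
    (hm : 1 < m) (hmn : m + 1 < n) (hl : 0 < l) :
    ∃ φ : PGammaLStabE F n l ≃* (attGraph F n l m ≃g attGraph F n l m),
      ∀ (g : PGammaLStabE F n l) (P : attX F n l m),
        (φ g P : Submodule F (Fin (n + l) → F)) =
          (g : PGammaL F (Fin (n + l) → F)) • (P : Submodule F (Fin (n + l) → F)) :=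
  lemma2p6_general F n l m hm hmn hl
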